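/- Let $n\ge 0$ be an integer, $\theta>0$ and $m\in\mathbb R$. Let $S_\theta=\{\zeta\in\mathbb C^n : |\operatorname{Im}\zeta_i|<\theta \text{ for all } i\}$, and let $H$ be a holomorphic function on $S_\theta$ such that for every multi-index $I$ there is a constant $C_I>0$ with $$|\partial_I H(\zeta)|\le C_I(1+|\zeta|)^{m-|I|},\qquad \zeta\in S_\theta .$$ For $f\in C_c^\infty(\mathbb R^n)$ put $\hat f(\xi)=\int_{\mathbb R^n}e^{-i\langle q,\xi\rangle}f(q)\,dq$. Then the integral $$\kappa(f)=\int_{\mathbb R^n}H(\xi)\hat f(\xi)\,d\xi,\qquad f\in C_c^\infty(\mathbb R^n),$$ converges absolutely and defines a distribution $\kappa$ on $\mathbb R^n$, and $\kappa$ is $C^\infty$ on $\mathbb R^n\setminus\{0\}$: there is a smooth function $k$ on $\mathbb R^n\setminus\{0\}$ with $\kappa(f)=\int k(p)f(p)\,dp$ for all $f\in C^\infty_c(\mathbb R^n)$ supported in $\mathbb R^n\setminus\{0\}$. Furthermore, for every $0<\varepsilon<\theta$ there is a smooth function $F:\mathbb R^n\to\mathbb C$, all of whose derivatives (of every order, including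 order $0$) are bounded, such that $$k(p)=e^{-\varepsilon|p|}F(p)\qquad\text{for all } p\in\mathbb R^n \text{ with } |p|>1,$$ where $|p|$ is the Euclidean norm. -/

import Mathlib

open scoped ContDiff Distributions

noncomputable section

namespace FourierDecay

/-- The strip of all `ζ ∈ ℂⁿ` with `|Im ζᵢ| < θ` for every `i`. -/
def strip (n : ℕ) (θ : ℝ) : Set (EuclideanSpace ℂ (Fin n)) :=
  {ζ | ∀ i, |(ζ i).im| < θ}

/-- The inclusion `ℝⁿ ⊆ ℂⁿ`. -/
def toComplex {n : ℕ} (ξ : EuclideanSpace ℝ (Fin n)) : EuclideanSpace ℂ (Fin n) :=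
  WithLp.toLp 2 fun i => (ξ i : ℂ)

/-- The complex partial derivative `∂H/∂ζᵢ`. -/
def partialDeriv {n : ℕ} (i : Fin n) (H : EuclideanSpace ℂ (Fin n) → ℂ) :
    EuclideanSpace ℂ (Fin n) → ℂ :=
  fun ζ => lineDeriv ℂ H ζ (EuclideanSpace.single i 1)

/-- The iterated partial derivative `∂_I H = ∂₁^{I₁} ⋯ ∂ₙ^{Iₙ} H` for a multi-index `I`. -/
def multiDeriv {n : ℕ} (I : Fin n → ℕ) (H : EuclideanSpace ℂ (Fin n) → ℂ) :
    EuclideanSpace ℂ (Fin n) → ℂ :=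
  (List.finRange n).foldr (fun i G => (partialDeriv i)^[I i] G) H

/-- The symbol estimates of order `m` on the strip: for every multi-index `I` there is a constant
`C` such that `|∂_I H(ζ)| ≤ C (1 + |ζ|)^(m - |I|)` on the strip (Euclidean norm on `ℂⁿ`). -/
def SymbolEstimates {n : ℕ} (θ m : ℝ) (H : EuclideanSpace ℂ (Fin n) → ℂ) : Prop :=
  ∀ I : Fin n → ℕ, ∃ C : ℝ, 0 < C ∧ ∀ ζ ∈ strip n θ,
    ‖multiDeriv I H ζ‖ ≤ C * (1 + ‖ζ‖) ^ (m - ((∑ i, I i : ℕ) : ℝ))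

/-- Complex-valued smooth functions with compact support on `ℝⁿ`. -/
abbrev Test (n : ℕ) : Type := 𝓓((⊤ : TopologicalSpace.Opens (EuclideanSpace ℝ (Fin n))), ℂ)

/-- The Fourier transform `ξ ↦ ∫ e^{-i⟨q, ξ⟩} f(q) dq`, with no factors of `2π`. -/
def fourier {n : ℕ} (f : EuclideanSpace ℝ (Fin n) → ℂ) (ξ : EuclideanSpace ℝ (Fin n)) : ℂ :=
  ∫ q, Complex.exp (-(Complex.I * ((inner ℝ q ξ : ℝ) : ℂ))) * f q

/-- The distribution `κ` is given by `f ↦ ∫ H(ξ) f̂(ξ) dξ`, the integral being over `ℝⁿ` and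
absolutely convergent for every test function `f`. -/
def IsFourierPairing {n : ℕ} (H : EuclideanSpace ℂ (Fin n) → ℂ) (κ : Test n →L[ℂ] ℂ) : Prop :=
  ∀ f : Test n,
    MeasureTheory.Integrable (fun ξ => H (toComplex ξ) * fourier f ξ) ∧
      κ f = ∫ ξ, H (toComplex ξ) * fourier f ξ

/-- On the open set `U` the distribution `κ` is the smooth function `k`. -/
def EqSmoothOn {n : ℕ} (κ : Test n →L[ℂ] ℂ) (U : Set (EuclideanSpace ℝ (Fin n)))
    (k : EuclideanSpace ℝ (Fin n) → ℂ) : Prop :=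
  ContDiffOn ℝ ∞ k U ∧ ∀ f : Test n, tsupport f ⊆ U → κ f = ∫ p, k p * f p

/-- Smooth functions on `ℝⁿ` all of whose derivatives, of every order `j ≥ 0`, are bounded. -/
def SmoothBounded {n : ℕ} (F : EuclideanSpace ℝ (Fin n) → ℂ) : Prop :=
  ContDiff ℝ ∞ F ∧ ∀ j : ℕ, ∃ C : ℝ, ∀ p, ‖iteratedFDeriv ℝ j F p‖ ≤ C

end FourierDecay

end

noncomputable section

open MeasureTheory Filter Topology Metric
open scoped SchwartzMap FourierTransform

namespace FourierDecay

/-! Differentiating the symbol improves its decay, and on the other side of the Fourier transform it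
is multiplication by coordinates. Integrating by parts, `powSum N` times κ is the distribution of
the symbol `derivSymbol N H`, of order `m - 2 * N` (`integral_mul_fourier_powSum_mul`). Once `2 * N
- m > n` this symbol is integrable on ℝⁿ, so Fubini makes the product a continuous function.
Dividing by `powSum N`, which vanishes only at the origin, gives `kernel N H`. Larger `N` gives more
derivatives, and all these kernels represent κ, so they agree off the origin (`kernel_eqOn_kernel`)
and each of them is smooth there.

For the decay, Cauchy's theorem moves the integral to ℝⁿ - iη with |η| < θ and yields a factor
exp(-⟨η, q⟩) (`fourier_derivSymbol_eq_exp_mul`). At q = p the choice η = εp/|p| makes it exp(-ε|p|).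
For derivatives at p, η is frozen at this value while q varies near p. Then exp(ε|q|) times the
kernel is a product of 1/`powSum`, exp(ε|q| - ⟨η, q⟩) and the transform of the shifted symbol.
Homogeneity bounds the derivatives at p of the first two factors uniformly for |p| ≥ 1/2, and
moments of the symbol bound those of the third, uniformly over |η| = ε. A cutoff removes the origin.
-/

/-! ### Holomorphy of derivatives in several variables -/

theorem norm_fderiv_le_of_norm_le_ball {E : Type*} [NormedAddCommGroup E] [NormedSpace ℂ E]
    {H : E → ℂ} {x : E} {R M : ℝ} (hR : 0 < R) (hd : DifferentiableOn ℂ H (ball x R))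
    (hM : ∀ y ∈ ball x R, ‖H y‖ ≤ M) : ‖fderiv ℂ H x‖ ≤ (2 * M) / R := by
  have hM0 : 0 ≤ M := (norm_nonneg _).trans (hM x (mem_ball_self hR))
  refine Complex.norm_fderiv_le_div_of_mapsTo_ball hd (fun y hy => ?_) hR
  rw [mem_closedBall, dist_eq_norm]
  have h1 := hM y hy
  have h2 := hM x (mem_ball_self hR)
  have h3 := norm_sub_le (H y) (H x)
  linarith

/-- Directional derivatives of a holomorphic function of several variables are holomorphic. -/
theorem differentiableOn_fderiv_apply {E : Type*} [NormedAddCommGroup E] [NormedSpace ℂ E]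
    [FiniteDimensional ℂ E] {H : E → ℂ} {U : Set E} (hU : IsOpen U)
    (hH : DifferentiableOn ℂ H U) (v : E) :
    DifferentiableOn ℂ (fun x => fderiv ℂ H x v) U := by
  intro x₀ hx₀
  apply DifferentiableAt.differentiableWithinAt
  have hcont : ContinuousAt H x₀ := (hH.differentiableAt (hU.mem_nhds hx₀)).continuousAt
  have hbdd : ∀ᶠ y in 𝓝 x₀, ‖H y‖ < ‖H x₀‖ + 1 :=
    hcont.norm.eventually (gt_mem_nhds (by linarith))
  obtain ⟨R, hR, hball⟩ := Metric.mem_nhds_iff.1 (Filter.inter_mem (hU.mem_nhds hx₀) hbdd)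
  set M := ‖H x₀‖ + 1
  have hsub : ball x₀ R ⊆ U := fun y hy => (hball hy).1
  have hM : ∀ y ∈ ball x₀ R, ‖H y‖ ≤ M := fun y hy => (hball hy).2.le
  -- With this radius, displacements `w • v` with `‖w‖ < 2 * r` have length at most R/2. They keep
  -- the ball of radius R/4 inside that of radius 3R/4, which leaves a margin R/4 for the bound on
  -- `fderiv`.
  set r := R / (4 * (1 + ‖v‖)) with hr
  have hv0 := norm_nonneg v
  have hr0 : 0 < r := by positivity
  have hrv : r * ‖v‖ ≤ R / 4 := by
    rw [hr, div_mul_eq_mul_div, div_le_div_iff₀ (by positivity) (by norm_num)]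
    nlinarith
  have hmem : ∀ x ∈ ball x₀ (R / 4), ∀ w : ℂ, ‖w‖ < 2 * r → x + w • v ∈ ball x₀ (3 * R / 4) := by
    intro x hx w hw
    rw [mem_ball, dist_eq_norm] at *
    calc ‖x + w • v - x₀‖ = ‖(x - x₀) + w • v‖ := by congr 1; abel
      _ ≤ ‖x - x₀‖ + ‖w‖ * ‖v‖ := (norm_add_le _ _).trans (by rw [norm_smul])
      _ < R / 4 + 2 * (R / 4) := by nlinarith
      _ = _ := by ring
  have hsub' : ball x₀ (3 * R / 4) ⊆ ball x₀ R := ball_subset_ball (by linarith)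
  have hfd : ∀ y ∈ ball x₀ (3 * R / 4), ‖fderiv ℂ H y‖ ≤ (2 * M) / (R / 4) := by
    intro y hy
    have hyb : ball y (R / 4) ⊆ ball x₀ R := by
      intro z hz
      rw [mem_ball] at *
      linarith [dist_triangle z y x₀]
    exact norm_fderiv_le_of_norm_le_ball (by linarith) (hH.mono (hyb.trans hsub))
      fun z hz => hM z (hyb hz)
  have hdiff : ∀ y ∈ ball x₀ (3 * R / 4), HasFDerivAt H (fderiv ℂ H y) y := fun y hy =>
    (hH.differentiableAt (hU.mem_nhds (hsub (hsub' hy)))).hasFDerivAt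
  have hcirc : ∀ t, ‖circleMap 0 r t‖ < 2 * r := by
    intro t
    simp [abs_of_pos hr0]; linarith
  -- Cauchy's formula for the derivative at 0 of the slice `w ↦ H (x + w • v)`. It involves only
  -- values of `H`, so one differentiation under the integral suffices.
  have hform : ∀ x ∈ ball x₀ (R / 4), fderiv ℂ H x v = (2 * Real.pi * Complex.I : ℂ)⁻¹ •
      ∫ t in (0 : ℝ)..2 * Real.pi, (deriv (circleMap 0 r) t * ((circleMap 0 r t) ^ 2)⁻¹) *
        H (x + circleMap 0 r t • v) := by
    intro x hx
    have hg : DifferentiableOn ℂ (fun w : ℂ => H (x + w • v)) (ball 0 (2 * r)) := by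
      intro w hw
      have := hdiff _ (hmem x hx w (by simpa using hw))
      exact (DifferentiableAt.comp (f := fun w : ℂ => x + w • v) w this.differentiableAt
        (by fun_prop)).differentiableWithinAt
    have h := Complex.two_pi_I_inv_smul_circleIntegral_sub_sq_inv_smul_of_differentiable
      isOpen_ball (c := 0) (R := r) (closedBall_subset_ball (by linarith)) hg (mem_ball_self hr0)
    have hder : deriv (fun w : ℂ => H (x + w • v)) 0 = fderiv ℂ H x v := by
      have h0 : HasFDerivAt H (fderiv ℂ H x) (x + (0 : ℂ) • v) := by
        simpa using hdiff x (by simpa using hmem x hx 0 (by simpa using hr0))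
      have h1 : HasDerivAt (fun w : ℂ => x + w • v) v 0 := by
        simpa using ((hasDerivAt_id (0 : ℂ)).smul_const v).const_add x
      exact (h0.comp_hasDerivAt (0 : ℂ) h1).deriv
    rw [← hder, ← h, circleIntegral]
    simp only [sub_zero, smul_eq_mul, mul_assoc]
  have key : HasFDerivAt (fun x => ∫ t in (0 : ℝ)..2 * Real.pi,
      (deriv (circleMap 0 r) t * ((circleMap 0 r t) ^ 2)⁻¹) * H (x + circleMap 0 r t • v))
      (∫ t in (0 : ℝ)..2 * Real.pi, (deriv (circleMap 0 r) t * ((circleMap 0 r t) ^ 2)⁻¹) •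
        fderiv ℂ H (x₀ + circleMap 0 r t • v)) x₀ := by
    have hw : ∀ t, circleMap 0 r t ≠ 0 := fun t => circleMap_ne_center hr0.ne'
    have hcc : Continuous fun t => deriv (circleMap 0 r) t * ((circleMap 0 r t) ^ 2)⁻¹ := by
      simp only [deriv_circleMap]
      have := continuous_circleMap 0 r
      refine Continuous.mul (by fun_prop) (Continuous.inv₀ (by fun_prop) fun t => pow_ne_zero _ (hw t))
    have hHc : ∀ x ∈ ball x₀ (R / 4), Continuous fun t : ℝ => H (x + circleMap 0 r t • v) := by
      intro x hx
      have hc : ContinuousOn H (ball x₀ (3 * R / 4)) := fun y hy =>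
        (hdiff y hy).continuousAt.continuousWithinAt
      have := continuous_circleMap 0 r
      exact hc.comp_continuous (by fun_prop) fun t => hmem x hx _ (hcirc t)
    have hx₀b : x₀ ∈ ball x₀ (R / 4) := mem_ball_self (by linarith)
    let := borel E
    have : BorelSpace E := ⟨rfl⟩
    have : ProperSpace E := FiniteDimensional.proper ℂ E
    have : FiniteDimensional ℂ (E →L[ℂ] ℂ) := inferInstance
    have : ProperSpace (E →L[ℂ] ℂ) := FiniteDimensional.proper ℂ _
    refine intervalIntegral.hasFDerivAt_integral_of_dominated_of_fderiv_le
      (s := ball x₀ (R / 4)) (F' := fun x t => (deriv (circleMap 0 r) t *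
        ((circleMap 0 r t) ^ 2)⁻¹) • fderiv ℂ H (x + circleMap 0 r t • v))
      (bound := fun t => ‖deriv (circleMap 0 r) t * ((circleMap 0 r t) ^ 2)⁻¹‖ *
        ((2 * M) / (R / 4)))
      (ball_mem_nhds _ (by linarith)) ?_ ?_ ?_ ?_ ?_ ?_
    · filter_upwards [ball_mem_nhds x₀ (show 0 < R / 4 by linarith)] with x hx
      exact (hcc.mul (hHc x hx)).aestronglyMeasurable
    · exact (hcc.mul (hHc x₀ hx₀b)).intervalIntegrable _ _
    · refine hcc.aestronglyMeasurable.smul ?_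
      -- Continuity of the derivative is not yet known; its measurability comes for free.
      have h1 := measurable_fderiv ℂ H
      have h2 : Measurable fun t : ℝ => x₀ + circleMap 0 r t • v :=
        (Continuous.measurable (by have := continuous_circleMap 0 r; fun_prop))
      exact (h1.comp h2).aestronglyMeasurable
    · refine Eventually.of_forall fun t _ x hx => ?_
      rw [norm_smul]
      exact mul_le_mul_of_nonneg_left (hfd _ (hmem x hx _ (hcirc t))) (norm_nonneg _)
    · exact (hcc.norm.mul continuous_const).intervalIntegrable _ _
    · refine Eventually.of_forall fun t _ x hx => ?_
      have h1 : HasFDerivAt (fun x => H (x + circleMap 0 r t • v))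
          (fderiv ℂ H (x + circleMap 0 r t • v)) x := by
        simpa using! (hdiff _ (hmem x hx _ (hcirc t))).comp x
          ((hasFDerivAt_id x).add_const (circleMap 0 r t • v))
      simpa using! h1.const_smul (deriv (circleMap 0 r) t * ((circleMap 0 r t) ^ 2)⁻¹)
  have h2 := (key.const_smul (2 * Real.pi * Complex.I : ℂ)⁻¹).differentiableAt
  refine h2.congr_of_eventuallyEq ?_
  filter_upwards [ball_mem_nhds x₀ (show 0 < R / 4 by linarith)] with x hx
  exact hform x hx

/-! ### The strip and pure partial derivatives -/

theorem isOpen_strip (n : ℕ) (θ : ℝ) : IsOpen (strip n θ) := by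
  have : strip n θ = ⋂ i, {ζ : EuclideanSpace ℂ (Fin n) | |(ζ i).im| < θ} := by
    ext ζ; simp [strip]
  rw [this]
  refine isOpen_iInter_of_finite fun i => isOpen_lt ?_ continuous_const
  fun_prop

theorem differentiableOn_iterate_partialDeriv {n : ℕ} {θ : ℝ}
    {H : EuclideanSpace ℂ (Fin n) → ℂ} (hH : DifferentiableOn ℂ H (strip n θ)) (i : Fin n)
    (k : ℕ) : DifferentiableOn ℂ ((partialDeriv i)^[k] H) (strip n θ) := by
  induction k with
  | zero => exact hH
  | succ k ih =>
    rw [Function.iterate_succ_apply']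
    refine (differentiableOn_fderiv_apply (isOpen_strip n θ) ih
      (EuclideanSpace.single i 1)).congr fun ζ hζ => ?_
    exact (ih.differentiableAt ((isOpen_strip n θ).mem_nhds hζ)).lineDeriv_eq_fderiv

theorem multiDeriv_single {n : ℕ} (i : Fin n) (k : ℕ) (H : EuclideanSpace ℂ (Fin n) → ℂ) :
    multiDeriv (Pi.single i k) H = (partialDeriv i)^[k] H := by
  have key : ∀ l : List (Fin n), l.Nodup → l.foldr
      (fun j G => (partialDeriv j)^[(Pi.single i k : Fin n → ℕ) j] G) H =
      if i ∈ l then (partialDeriv i)^[k] H else H := by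
    intro l
    induction l with
    | nil => simp
    | cons a l ih =>
      intro hl
      rw [List.nodup_cons] at hl
      rw [List.foldr_cons, ih hl.2]
      by_cases ha : a = i
      · subst ha
        simp [hl.1]
      · simp [ha, Ne.symm ha]
  rw [multiDeriv, key _ (List.nodup_finRange n), if_pos (List.mem_finRange i)]

theorem SymbolEstimates.norm_iterate_partialDeriv_le {n : ℕ} {θ m : ℝ}
    {H : EuclideanSpace ℂ (Fin n) → ℂ} (h : SymbolEstimates θ m H) (i : Fin n) (k : ℕ) :
    ∃ C : ℝ, 0 < C ∧ ∀ ζ ∈ strip n θ,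
      ‖(partialDeriv i)^[k] H ζ‖ ≤ C * (1 + ‖ζ‖) ^ (m - (k : ℝ)) := by
  obtain ⟨C, hC, h⟩ := h (Pi.single i k)
  refine ⟨C, hC, fun ζ hζ => ?_⟩
  have := h ζ hζ
  rw [multiDeriv_single] at this
  simpa using this

@[simp]
theorem toComplex_apply {n : ℕ} (ξ : EuclideanSpace ℝ (Fin n)) (i : Fin n) :
    toComplex ξ i = (ξ i : ℂ) := rfl

@[simp]
theorem norm_toComplex {n : ℕ} (ξ : EuclideanSpace ℝ (Fin n)) : ‖toComplex ξ‖ = ‖ξ‖ := by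
  simp [EuclideanSpace.norm_eq]

theorem toComplex_add {n : ℕ} (ξ η : EuclideanSpace ℝ (Fin n)) :
    toComplex (ξ + η) = toComplex ξ + toComplex η := by
  ext i; simp

theorem toComplex_smul {n : ℕ} (t : ℝ) (ξ : EuclideanSpace ℝ (Fin n)) :
    toComplex (t • ξ) = (t : ℂ) • toComplex ξ := by
  ext i; simp

@[fun_prop]
theorem continuous_toComplex {n : ℕ} : Continuous (toComplex (n := n)) := by
  unfold toComplex
  fun_prop

theorem toComplex_add_mem_strip {n : ℕ} {θ : ℝ} {ζ : EuclideanSpace ℂ (Fin n)}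
    (ξ : EuclideanSpace ℝ (Fin n)) (hζ : ζ ∈ strip n θ) : toComplex ξ + ζ ∈ strip n θ := by
  intro i
  simpa using hζ i

theorem toComplex_mem_strip {n : ℕ} {θ : ℝ} (hθ : 0 < θ) (ξ : EuclideanSpace ℝ (Fin n)) :
    toComplex ξ ∈ strip n θ := by
  intro i
  simpa using hθ

/-! ### Shifting the domain of integration -/

/-- Peetre's inequality for a displacement of bounded size. -/
theorem one_add_norm_rpow_neg_le {E : Type*} [SeminormedAddCommGroup E] {x y : E} {s R : ℝ}
    (hs : 0 ≤ s) (hy : ‖y‖ ≤ R) :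
    (1 + ‖x + y‖) ^ (-s) ≤ (1 + R) ^ s * (1 + ‖x‖) ^ (-s) := by
  have hx0 := norm_nonneg x
  have hy0 := norm_nonneg y
  have hxy0 := norm_nonneg (x + y)
  have h : 1 + ‖x‖ ≤ (1 + R) * (1 + ‖x + y‖) := by
    have : ‖x‖ ≤ ‖x + y‖ + ‖y‖ := by simpa using norm_sub_le (x + y) y
    nlinarith
  have h2 := Real.rpow_le_rpow (by positivity) h hs
  rw [Real.mul_rpow (by linarith) (by positivity)] at h2
  rw [Real.rpow_neg (by positivity), Real.rpow_neg (by positivity), ← div_eq_mul_inv,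
    le_div_iff₀ (by positivity), inv_mul_le_iff₀ (by positivity)]
  linarith

theorem integrable_of_continuous_of_le {n : ℕ} {u : EuclideanSpace ℝ (Fin n) → ℂ} {C s : ℝ}
    (hs : (n : ℝ) < s) (hu : Continuous u) (hC : ∀ ξ, ‖u ξ‖ ≤ C * (1 + ‖ξ‖) ^ (-s)) :
    Integrable u :=
  ((integrable_one_add_norm (by simpa using hs)).const_mul C).mono' hu.aestronglyMeasurable
    (Eventually.of_forall hC)

theorem ContinuousOn.continuous_comp_toComplex_add {n : ℕ} {θ : ℝ}
    {K : EuclideanSpace ℂ (Fin n) → ℂ} (hK : ContinuousOn K (strip n θ))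
    {ζ : EuclideanSpace ℂ (Fin n)} (hζ : ζ ∈ strip n θ) :
    Continuous fun ξ => K (toComplex ξ + ζ) :=
  hK.comp_continuous (by fun_prop) fun ξ => toComplex_add_mem_strip ξ hζ

/-- Cauchy's theorem: the integral over `ℝⁿ` of a decaying holomorphic function on a strip may be
shifted in an imaginary direction. -/
theorem integral_toComplex_eq_integral_add {n : ℕ} {θ s C : ℝ}
    {K : EuclideanSpace ℂ (Fin n) → ℂ} (hK : DifferentiableOn ℂ K (strip n θ))
    (hs : (n : ℝ) < s) (hC : ∀ ζ ∈ strip n θ, ‖K ζ‖ ≤ C * (1 + ‖ζ‖) ^ (-s))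
    {η : EuclideanSpace ℝ (Fin n)} (hη : ∀ i, |η i| < θ) :
    ∫ ξ, K (toComplex ξ) = ∫ ξ, K (toComplex ξ + Complex.I • toComplex η) := by
  have hs0 : 0 ≤ s := le_trans (Nat.cast_nonneg n) hs.le
  -- Room beyond 1 is needed so that the open strip `S` of parameters contains both 0 and
  -- `Complex.I`.
  obtain ⟨δ, hδ, hδη⟩ : ∃ δ : ℝ, 1 < δ ∧ ∀ i, δ * |η i| < θ := by
    have h : ∀ i, ∀ᶠ δ : ℝ in 𝓝 1, δ * |η i| < θ := fun i => by
      have : ContinuousAt (fun δ : ℝ => δ * |η i|) 1 := by fun_prop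
      exact this.eventually (gt_mem_nhds (by simpa using hη i))
    obtain ⟨δ, h1, h2⟩ := ((((eventually_all.2 h).filter_mono nhdsWithin_le_nhds).and
      (self_mem_nhdsWithin (a := (1 : ℝ)) (s := Set.Ioi 1))).exists)
    exact ⟨δ, h2, h1⟩
  set S : Set ℂ := {z | |z.im| < δ} with hS
  have hSo : IsOpen S := isOpen_lt (by fun_prop) continuous_const
  have hSc : Convex ℝ S := by
    have : S = Complex.imLm ⁻¹' (ball 0 δ) := by ext z; simp [hS]
    rw [this]
    exact (convex_ball 0 δ).linear_preimage _
  have hmem : ∀ z ∈ S, z • toComplex η ∈ strip n θ := by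
    intro z hz i
    have hz' : |z.im| < δ := hz
    have : |z.im| * |η i| ≤ δ * |η i| := mul_le_mul_of_nonneg_right hz'.le (abs_nonneg _)
    simpa [abs_mul] using this.trans_lt (hδη i)
  set Φ : ℂ → ℂ := fun z => ∫ ξ, K (toComplex ξ + z • toComplex η) with hΦ
  have hline : ∀ ξ, DifferentiableOn ℂ (fun z : ℂ => K (toComplex ξ + z • toComplex η)) S := by
    intro ξ
    exact hK.comp (g := K) (f := fun z : ℂ => toComplex ξ + z • toComplex η) (by fun_prop)
      fun z hz => toComplex_add_mem_strip ξ (hmem z hz)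
  have hcont : ∀ z ∈ S, Continuous fun ξ => K (toComplex ξ + z • toComplex η) := fun z hz =>
    ContinuousOn.continuous_comp_toComplex_add hK.continuousOn (hmem z hz)
  have hC0 : 0 ≤ C := by
    have h := (norm_nonneg _).trans (hC _ (hmem 0 (by simp [hS]; linarith)))
    simpa using h
  have hbound : ∀ z ∈ S, ∀ ρ, ‖z‖ ≤ ρ → ∀ ξ, ‖K (toComplex ξ + z • toComplex η)‖ ≤
      C * (1 + ρ * ‖η‖) ^ s * (1 + ‖ξ‖) ^ (-s) := by
    intro z hz ρ hρ ξ
    refine (hC _ (toComplex_add_mem_strip ξ (hmem z hz))).trans ?_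
    rw [mul_assoc]
    refine mul_le_mul_of_nonneg_left ?_ hC0
    have := one_add_norm_rpow_neg_le (x := toComplex ξ) (y := z • toComplex η) (R := ρ * ‖η‖) hs0
      (by rw [norm_smul, norm_toComplex]; exact mul_le_mul_of_nonneg_right hρ (norm_nonneg _))
    simpa using this
  have hΦd : ∀ z ∈ S, DifferentiableAt ℂ Φ z := by
    intro z hz
    obtain ⟨r, hr, hball⟩ := Metric.isOpen_iff.1 hSo z hz
    -- Cauchy estimates on circles of radius r/4 about points of the ball of radius r/2 give an
    -- integrable bound for the derivative, independent of `w`.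
    have hsub : ∀ w ∈ ball z (r / 2), closedBall w (r / 4) ⊆ ball z r := fun w hw x hx => by
      rw [mem_ball, mem_closedBall] at *
      linarith [dist_triangle x w z]
    set A := C * (1 + (‖z‖ + r) * ‖η‖) ^ s
    have hA : 0 ≤ A := by positivity
    have hdz : ∀ w ∈ ball z (r / 2), ∀ ξ, HasDerivAt (fun z : ℂ => K (toComplex ξ + z • toComplex η))
        (deriv (fun z : ℂ => K (toComplex ξ + z • toComplex η)) w) w := fun w hw ξ =>
      ((hline ξ).differentiableAt (hSo.mem_nhds (hball (hsub w hw
        (mem_closedBall_self (by linarith)))))).hasDerivAt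
    refine (hasDerivAt_integral_of_dominated_loc_of_deriv_le
      (F := fun z ξ => K (toComplex ξ + z • toComplex η))
      (F' := fun w ξ => deriv (fun z : ℂ => K (toComplex ξ + z • toComplex η)) w)
      (bound := fun ξ => A * (1 + ‖ξ‖) ^ (-s) / (r / 4))
      (ball_mem_nhds z (show 0 < r / 2 by linarith)) ?_ ?_ ?_ ?_ ?_ ?_).2.differentiableAt
    · filter_upwards [hSo.mem_nhds hz] with w hw
      exact (hcont w hw).aestronglyMeasurable
    · exact integrable_of_continuous_of_le hs (hcont z hz) (hbound z hz _ le_rfl)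
    · have hd : ∀ ξ, deriv (fun z : ℂ => K (toComplex ξ + z • toComplex η)) z =
          fderiv ℂ K (toComplex ξ + z • toComplex η) (toComplex η) := by
        intro ξ
        have h0 : HasFDerivAt K (fderiv ℂ K (toComplex ξ + z • toComplex η))
            (toComplex ξ + z • toComplex η) :=
          (hK.differentiableAt ((isOpen_strip n θ).mem_nhds
            (toComplex_add_mem_strip ξ (hmem z hz)))).hasFDerivAt
        have h1 : HasDerivAt (fun w : ℂ => toComplex ξ + w • toComplex η) (toComplex η) z := by
          simpa using ((hasDerivAt_id z).smul_const (toComplex η)).const_add (toComplex ξ)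
        exact (h0.comp_hasDerivAt z h1).deriv
      simp only [hd]
      exact (ContinuousOn.continuous_comp_toComplex_add (differentiableOn_fderiv_apply
        (isOpen_strip n θ) hK (toComplex η)).continuousOn (hmem z hz)).aestronglyMeasurable
    · refine Eventually.of_forall fun ξ w hw => ?_
      refine Complex.norm_deriv_le_of_forall_mem_sphere_norm_le (by linarith) ?_ fun x hx => ?_
      · refine ((hline ξ).mono ?_).diffContOnCl
        rw [closure_ball _ (by linarith)]
        exact (hsub w hw).trans hball
      · have hx' := hsub w hw (sphere_subset_closedBall hx)
        refine hbound x (hball hx') _ ?_ ξ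
        rw [mem_ball, dist_eq_norm] at hx'
        linarith [norm_le_norm_add_norm_sub' x z]
    · exact ((integrable_one_add_norm (by simpa using hs)).const_mul A).div_const _
    · exact Eventually.of_forall fun ξ w hw => hdz w hw ξ
  -- A real change of the parameter is a translation of ℝⁿ, which preserves Lebesgue measure. So the
  -- holomorphic function `Φ` has zero derivative along the real direction, hence zero complex
  -- derivative.
  have hinv : ∀ z, ∀ t : ℝ, Φ (z + t) = Φ z := by
    intro z t
    have h : ∀ ξ : EuclideanSpace ℝ (Fin n), K (toComplex ξ + (z + t) • toComplex η) =
        (fun ξ => K (toComplex ξ + z • toComplex η)) (ξ + t • η) := by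
      intro ξ
      simp only [toComplex_add, toComplex_smul, add_smul]
      congr 1; abel
    simp only [hΦ, h]
    exact integral_add_right_eq_self (μ := volume)
      (fun ξ => K (toComplex ξ + z • toComplex η)) (t • η)
  have hderiv : S.EqOn (deriv Φ) 0 := by
    intro z hz
    have h1 : HasDerivAt (fun t : ℝ => Φ (z + t)) (deriv Φ z) 0 := by
      have h2 : HasDerivAt Φ (deriv Φ z) (z + ((0 : ℝ) : ℂ)) := by
        simpa using (hΦd z hz).hasDerivAt
      have h3 : HasDerivAt (fun t : ℝ => z + (t : ℂ)) 1 0 := by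
        simpa using (Complex.ofRealCLM.hasDerivAt (x := (0 : ℝ))).const_add z
      simpa using! h2.comp (0 : ℝ) h3
    simp only [hinv] at h1
    exact h1.unique (hasDerivAt_const _ _)
  have := hSo.is_const_of_deriv_eq_zero hSc.isPreconnected
    (fun z hz => (hΦd z hz).differentiableWithinAt) hderiv
    (show (0 : ℂ) ∈ S by simp [hS]; linarith) (show Complex.I ∈ S by simpa [hS] using hδ)
  simpa [hΦ] using this

/-! ### The Fourier transform of integrable functions -/

/-- The bilinear form for which `fourier` is Mathlib's vector-valued Fourier integral. -/
def fourierForm (n : ℕ) :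
    EuclideanSpace ℝ (Fin n) →L[ℝ] EuclideanSpace ℝ (Fin n) →L[ℝ] ℝ :=
  (2 * Real.pi)⁻¹ • innerSL ℝ

theorem fourierForm_apply {n : ℕ} (x y : EuclideanSpace ℝ (Fin n)) :
    fourierForm n x y = (2 * Real.pi)⁻¹ * inner ℝ x y := rfl

theorem fourier_eq_fourierIntegral {n : ℕ} (f : EuclideanSpace ℝ (Fin n) → ℂ) :
    fourier f = VectorFourier.fourierIntegral 𝐞 volume (fourierForm n).toLinearMap₁₂ f := by
  ext ξ
  rw [fourier, VectorFourier.fourierIntegral]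
  congr 1
  ext q
  rw [Circle.smul_def, Real.fourierChar_apply, smul_eq_mul]
  congr 2
  rw [show (fourierForm n).toLinearMap₁₂ q ξ = (2 * Real.pi)⁻¹ * inner ℝ q ξ from rfl]
  push_cast
  have : (Real.pi : ℂ) ≠ 0 := by exact_mod_cast Real.pi_ne_zero
  field_simp

/-- Fubini, together with the symmetry of the bilinear form. -/
theorem integral_mul_fourier_comm {n : ℕ} {u f : EuclideanSpace ℝ (Fin n) → ℂ}
    (hu : Integrable u) (hf : Integrable f) :
    ∫ ξ, u ξ * fourier f ξ = ∫ p, fourier u p * f p := by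
  have h := VectorFourier.integral_fourierIntegral_smul_eq_flip (e := 𝐞) (μ := volume)
    (ν := volume) (L := (fourierForm n).toLinearMap₁₂) Real.continuous_fourierChar
    ((fourierForm n).continuous₂) hu hf
  have hflip : (fourierForm n).toLinearMap₁₂.flip = (fourierForm n).toLinearMap₁₂ := by
    ext x y
    simp [fourierForm_apply, real_inner_comm]
  rw [hflip, ← fourier_eq_fourierIntegral, ← fourier_eq_fourierIntegral] at h
  simpa using h.symm

theorem contDiff_fourier {n N : ℕ} {u : EuclideanSpace ℝ (Fin n) → ℂ}
    (hu : ∀ j ≤ N, Integrable fun ξ => ‖ξ‖ ^ j * ‖u ξ‖) : ContDiff ℝ N (fourier u) := by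
  rw [fourier_eq_fourierIntegral]
  exact VectorFourier.contDiff_fourierIntegral (fourierForm n) (N := N)
    fun j hj => hu j (by exact_mod_cast hj)

theorem norm_iteratedFDeriv_fourier_le {n j : ℕ} {u : EuclideanSpace ℝ (Fin n) → ℂ}
    (hm : AEStronglyMeasurable u) (hu : ∀ i ≤ j, Integrable fun ξ => ‖ξ‖ ^ i * ‖u ξ‖)
    (p : EuclideanSpace ℝ (Fin n)) :
    ‖iteratedFDeriv ℝ j (fourier u) p‖ ≤
      (2 * Real.pi * ‖fourierForm n‖) ^ j * ∫ ξ, ‖ξ‖ ^ j * ‖u ξ‖ := by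
  rw [fourier_eq_fourierIntegral, VectorFourier.iteratedFDeriv_fourierIntegral (fourierForm n)
    (N := j) (fun i hi => hu i (by exact_mod_cast hi)) hm le_rfl]
  refine (VectorFourier.norm_fourierIntegral_le_integral_norm _ _ _ _ _).trans ?_
  rw [← integral_const_mul]
  refine integral_mono_of_nonneg (Eventually.of_forall fun _ => norm_nonneg _)
    ((hu j le_rfl).const_mul _) (Eventually.of_forall fun ξ => ?_)
  simpa [mul_assoc] using VectorFourier.norm_fourierPowSMulRight_le (fourierForm n) u ξ j

/-! ### Schwartz functions and symbols of polynomial growth -/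

theorem fourier_eq_real_fourier {n : ℕ} (f : EuclideanSpace ℝ (Fin n) → ℂ)
    (ξ : EuclideanSpace ℝ (Fin n)) : fourier f ξ = 𝓕 f ((2 * Real.pi)⁻¹ • ξ) := by
  rw [fourier, Real.fourier_eq']
  congr 1
  ext q
  rw [smul_eq_mul, inner_smul_right]
  congr 2
  push_cast
  have : (Real.pi : ℂ) ≠ 0 := by exact_mod_cast Real.pi_ne_zero
  field_simp

/-- The Fourier transform of `fourier` as an operator on Schwartz functions. -/
def fourierSchwartz (n : ℕ) :
    𝓢(EuclideanSpace ℝ (Fin n), ℂ) →L[ℂ] 𝓢(EuclideanSpace ℝ (Fin n), ℂ) :=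
  (SchwartzMap.compCLM ℂ (g := fun ξ : EuclideanSpace ℝ (Fin n) => (2 * Real.pi)⁻¹ • ξ)
    (by fun_prop) ⟨1, 2 * Real.pi, fun x => by
      rw [norm_smul, Real.norm_of_nonneg (by positivity), pow_one, mul_add, ← mul_assoc,
        mul_inv_cancel₀ (by positivity)]
      linarith [Real.pi_pos]⟩) ∘L FourierTransform.fourierCLM ℂ _

@[simp]
theorem fourierSchwartz_apply {n : ℕ} (φ : 𝓢(EuclideanSpace ℝ (Fin n), ℂ))
    (ξ : EuclideanSpace ℝ (Fin n)) : fourierSchwartz n φ ξ = fourier φ ξ := by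
  rw [fourier_eq_real_fourier]
  rfl

theorem hasLineDerivAt_fourier {n : ℕ} (φ : 𝓢(EuclideanSpace ℝ (Fin n), ℂ))
    (ξ v : EuclideanSpace ℝ (Fin n)) :
    HasLineDerivAt ℝ (fourier φ)
      (-Complex.I * fourier (fun q => ((inner ℝ q v : ℝ) : ℂ) * φ q) ξ) ξ v := by
  have hg : Function.HasTemperateGrowth (fun q : EuclideanSpace ℝ (Fin n) => inner ℝ q v) :=
    ((innerSL ℝ).flip v).hasTemperateGrowth
  set ψ : 𝓢(EuclideanSpace ℝ (Fin n), ℂ) := SchwartzMap.smulLeftCLM ℂ (inner ℝ · v) φ with hψ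
  have h1 := (((𝓕 φ).differentiableAt (x := (2 * Real.pi)⁻¹ • ξ)).hasFDerivAt).hasLineDerivAt
    ((2 * Real.pi)⁻¹ • v)
  have h2 := congrArg (fun χ : 𝓢(EuclideanSpace ℝ (Fin n), ℂ) => χ ((2 * Real.pi)⁻¹ • ξ))
    (SchwartzMap.lineDerivOp_fourier_eq φ v)
  simp only [SchwartzMap.lineDerivOp_apply_eq_fderiv] at h2
  rw [map_smul, h2, FourierTransform.fourier_smul, ← hψ, smul_apply] at h1
  have h3 : (𝓕 ψ : 𝓢(EuclideanSpace ℝ (Fin n), ℂ)) ((2 * Real.pi)⁻¹ • ξ) =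
      fourier (fun q => ((inner ℝ q v : ℝ) : ℂ) * φ q) ξ := by
    have : (fun q => ((inner ℝ q v : ℝ) : ℂ) * φ q) = ψ := by
      ext q; rw [hψ, SchwartzMap.smulLeftCLM_apply_apply hg, Complex.real_smul]
    rw [this, fourier_eq_real_fourier]
    rfl
  rw [h3] at h1
  rw [HasLineDerivAt] at h1 ⊢
  have h4 : (fun t : ℝ => fourier φ (ξ + t • v)) =
      fun t : ℝ => (𝓕 φ : 𝓢(EuclideanSpace ℝ (Fin n), ℂ))
        ((2 * Real.pi)⁻¹ • ξ + t • (2 * Real.pi)⁻¹ • v) := by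
    ext t
    rw [fourier_eq_real_fourier, smul_add, smul_comm]
    rfl
  rw [h4]
  convert h1 using 1
  rw [Complex.real_smul, smul_eq_mul]
  push_cast
  have : (Real.pi : ℂ) ≠ 0 := by exact_mod_cast Real.pi_ne_zero
  field_simp

/-- A continuous function of polynomial growth pairs continuously with Schwartz functions. -/
theorem exists_pairing_schwartz {n : ℕ} {u : EuclideanSpace ℝ (Fin n) → ℂ} {C m : ℝ}
    (hu : Continuous u) (hC : ∀ ξ, ‖u ξ‖ ≤ C * (1 + ‖ξ‖) ^ m) :
    ∃ L : 𝓢(EuclideanSpace ℝ (Fin n), ℂ) →L[ℂ] ℂ,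
      ∀ ψ, Integrable (fun ξ => u ξ * ψ ξ) ∧ L ψ = ∫ ξ, u ξ * ψ ξ := by
  -- The weight of power `k` absorbs the growth of order `m` and leaves the integrable factor of
  -- power `-(n + 1)`.
  obtain ⟨k, hk⟩ := exists_nat_ge (m + (n + 1))
  have hC0 : 0 ≤ C := by simpa using (norm_nonneg _).trans (hC 0)
  have hs : (n : ℝ) < (n : ℝ) + 1 := by linarith
  set P : 𝓢(EuclideanSpace ℝ (Fin n), ℂ) → ℝ := fun ψ =>
    2 ^ k * ((Finset.Iic (k, 0)).sup fun l => SchwartzMap.seminorm ℂ l.1 l.2) ψ with hP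
  have hbound : ∀ (ψ : 𝓢(EuclideanSpace ℝ (Fin n), ℂ)) ξ,
      ‖u ξ * ψ ξ‖ ≤ (C * P ψ) * (1 + ‖ξ‖) ^ (-((n : ℝ) + 1)) := by
    intro ψ ξ
    have h1 : (1 + ‖ξ‖) ^ k * ‖ψ ξ‖ ≤ P ψ := by
      simpa using SchwartzMap.one_add_le_sup_seminorm_apply (𝕜 := ℂ) (m := (k, 0)) (k := k)
        (n := 0) le_rfl le_rfl ψ ξ
    have h2 : (1 + ‖ξ‖) ^ m ≤ (1 + ‖ξ‖) ^ (-((n : ℝ) + 1)) * (1 + ‖ξ‖) ^ k := by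
      rw [← Real.rpow_natCast, ← Real.rpow_add (by positivity)]
      exact Real.rpow_le_rpow_of_exponent_le (by linarith [norm_nonneg ξ]) (by linarith)
    calc ‖u ξ * ψ ξ‖ = ‖u ξ‖ * ‖ψ ξ‖ := norm_mul _ _
      _ ≤ (C * ((1 + ‖ξ‖) ^ (-((n : ℝ) + 1)) * (1 + ‖ξ‖) ^ k)) * ‖ψ ξ‖ := by
          refine mul_le_mul_of_nonneg_right ((hC ξ).trans ?_) (norm_nonneg _)
          exact mul_le_mul_of_nonneg_left h2 hC0
      _ = (C * (1 + ‖ξ‖) ^ (-((n : ℝ) + 1))) * ((1 + ‖ξ‖) ^ k * ‖ψ ξ‖) := by ring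
      _ ≤ (C * (1 + ‖ξ‖) ^ (-((n : ℝ) + 1))) * P ψ := by gcongr
      _ = _ := by ring
  have hint : ∀ ψ : 𝓢(EuclideanSpace ℝ (Fin n), ℂ), Integrable (fun ξ => u ξ * ψ ξ) :=
    fun ψ => integrable_of_continuous_of_le hs (hu.mul ψ.continuous) (hbound ψ)
  set J : ℝ := ∫ ξ : EuclideanSpace ℝ (Fin n), (1 + ‖ξ‖) ^ (-((n : ℝ) + 1))
  have hJ : 0 ≤ J := integral_nonneg fun ξ => by positivity
  refine ⟨SchwartzMap.mkCLMtoNormedSpace (𝕜 := ℂ) (σ := RingHom.id ℂ)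
    (fun ψ => ∫ ξ, u ξ * ψ ξ) ?_ ?_ ⟨Finset.Iic (k, 0), C * 2 ^ k * J, by positivity, ?_⟩,
    fun ψ => ⟨hint ψ, rfl⟩⟩
  · intro f g
    rw [← integral_add (hint f) (hint g)]
    congr 1; ext ξ; rw [add_apply, mul_add]
  · intro a f
    rw [RingHom.id_apply, smul_eq_mul, ← integral_const_mul]
    congr 1; ext ξ; rw [smul_apply, smul_eq_mul]; ring
  · intro ψ
    have h := norm_integral_le_of_norm_le
      ((integrable_one_add_norm (μ := (volume : Measure (EuclideanSpace ℝ (Fin n))))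
        (by simp)).const_mul (C * P ψ))
      (Eventually.of_forall (hbound ψ))
    rw [integral_const_mul] at h
    refine h.trans (le_of_eq ?_)
    simp only [hP]
    change _ = C * 2 ^ k * J * ((Finset.Iic (k, 0)).sup fun l => SchwartzMap.seminorm ℂ l.1 l.2) ψ
    ring

/-- Integration by parts against a Fourier transform. -/
theorem integral_mul_fourier_inner_mul {n : ℕ} {u u' : EuclideanSpace ℝ (Fin n) → ℂ}
    {C C' m m' : ℝ} (hu : Continuous u) (hC : ∀ ξ, ‖u ξ‖ ≤ C * (1 + ‖ξ‖) ^ m)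
    (hu' : Continuous u') (hC' : ∀ ξ, ‖u' ξ‖ ≤ C' * (1 + ‖ξ‖) ^ m')
    {v : EuclideanSpace ℝ (Fin n)} (hd : ∀ ξ, HasLineDerivAt ℝ u (u' ξ) ξ v)
    (φ : 𝓢(EuclideanSpace ℝ (Fin n), ℂ)) :
    ∫ ξ, u ξ * fourier (fun q => ((inner ℝ q v : ℝ) : ℂ) * φ q) ξ =
      -Complex.I * ∫ ξ, u' ξ * fourier φ ξ := by
  obtain ⟨L, hL⟩ := exists_pairing_schwartz hu hC
  obtain ⟨L', hL'⟩ := exists_pairing_schwartz hu' hC'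
  have hg : Function.HasTemperateGrowth (fun q : EuclideanSpace ℝ (Fin n) => inner ℝ q v) :=
    ((innerSL ℝ).flip v).hasTemperateGrowth
  have hψ : (fun q => ((inner ℝ q v : ℝ) : ℂ) * φ q) =
      (SchwartzMap.smulLeftCLM ℂ (inner ℝ · v) φ : 𝓢(EuclideanSpace ℝ (Fin n), ℂ)) := by
    ext q; rw [SchwartzMap.smulLeftCLM_apply_apply hg, Complex.real_smul]
  have h1 := (hL (fourierSchwartz n φ)).1
  have h2 := (hL' (fourierSchwartz n φ)).1
  have h3 := (hL (fourierSchwartz n (SchwartzMap.smulLeftCLM ℂ (inner ℝ · v) φ))).1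
  simp only [fourierSchwartz_apply, ← hψ] at h1 h2 h3
  have h := integral_bilinear_hasLineDerivAt_right_eq_neg_left_of_integrable
    (μ := volume) (f := u) (f' := u') (g := fourier φ)
    (g' := fun ξ => -Complex.I * fourier (fun q => ((inner ℝ q v : ℝ) : ℂ) * φ q) ξ)
    (v := v) (B := ContinuousLinearMap.mul ℝ ℂ) (by simpa using h2)
    (by simpa [mul_left_comm] using h3.const_mul (-Complex.I)) (by simpa using h1)
    (fun ξ _ => hd ξ) (fun ξ _ => hasLineDerivAt_fourier φ ξ v)
  simp only [ContinuousLinearMap.mul_apply', mul_left_comm _ (-Complex.I)] at h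
  rw [integral_const_mul] at h
  have hI := Complex.I_mul_I
  linear_combination Complex.I * h +
    (∫ ξ, u ξ * fourier (fun q => ((inner ℝ q v : ℝ) : ℂ) * φ q) ξ) * hI

/-! ### From tempered distributions to distributions -/

/-- A test function, regarded as a Schwartz function. -/
def Test.toSchwartz {n : ℕ} (f : Test n) : 𝓢(EuclideanSpace ℝ (Fin n), ℂ) :=
  f.hasCompactSupport.toSchwartzMap f.contDiff

/-- Every tempered distribution is a distribution. -/
theorem exists_distribution_of_schwartz {n : ℕ} (L : 𝓢(EuclideanSpace ℝ (Fin n), ℂ) →L[ℂ] ℂ) :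
    ∃ κ : Test n →L[ℂ] ℂ, ∀ f, κ f = L f.toSchwartz := by
  refine ⟨TestFunction.mkCLM ℂ (fun f => L (Test.toSchwartz f)) ?_ ?_ ?_, fun f => rfl⟩
  · intro f g
    rw [← map_add]; congr 1
  · intro c f
    rw [← map_smul]; congr 1
  -- It suffices to prove continuity on test functions supported in a fixed compact `K`. There the
  -- polynomial weights in the Schwartz seminorms are bounded, so only sup norms of derivatives
  -- remain.
  · intro K hK
    obtain ⟨s, C, -, hL⟩ := Seminorm.bound_of_continuous
      (schwartz_withSeminorms ℂ (EuclideanSpace ℝ (Fin n)) ℂ) (normSeminorm ℂ ℂ |>.comp L.toLinearMap)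
      (continuous_norm.comp L.continuous)
    obtain ⟨R, hR⟩ := K.isCompact.isBounded.exists_norm_le
    -- The bound `R` may be negative when `K` is empty.
    have hR0 : 0 ≤ max R 0 := le_max_right _ _
    refine (ContDiffMapSupportedIn.mkCLMtoNormedSpace ℂ (n := ⊤) (K := K)
      (fun f => L (Test.toSchwartz (TestFunction.ofSupportedIn hK f))) ?_ ?_
      ⟨s.image Prod.snd, C * ∑ l ∈ s, (max R 0) ^ l.1, by positivity, ?_⟩).continuous
    · intro f g
      rw [← map_add]; congr 1
    · intro c f
      rw [← map_smul]; congr 1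
    · intro f
      set p := (s.image Prod.snd).sup fun i => ContDiffMapSupportedIn.seminorm ℂ
        (EuclideanSpace ℝ (Fin n)) ℂ ⊤ K i with hp
      set φ := Test.toSchwartz (TestFunction.ofSupportedIn hK f)
      have h1 : ‖L φ‖ ≤ C * (s.sup (schwartzSeminormFamily ℂ (EuclideanSpace ℝ (Fin n)) ℂ)) φ :=
        hL φ
      refine h1.trans ?_
      rw [mul_assoc]
      refine mul_le_mul_of_nonneg_left ?_ C.coe_nonneg
      have h2 : ∀ l ∈ s, SchwartzMap.seminorm ℂ l.1 l.2 φ ≤ (max R 0) ^ l.1 * p f := by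
        intro l hl
        refine SchwartzMap.seminorm_le_bound ℂ _ _ _ (by positivity) fun x => ?_
        have hle : ‖iteratedFDeriv ℝ l.2 φ x‖ ≤ p f :=
          (ContDiffMapSupportedIn.norm_iteratedFDeriv_apply_le_seminorm_top ℂ (f := f)).trans
            (Seminorm.le_finset_sup_apply (p := fun i => ContDiffMapSupportedIn.seminorm ℂ
              (EuclideanSpace ℝ (Fin n)) ℂ ⊤ K i) (Finset.mem_image_of_mem _ hl))
        by_cases hx : x ∈ K
        · have : ‖x‖ ≤ max R 0 := (hR x hx).trans (le_max_left _ _)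
          gcongr
        · have h0 : iteratedFDeriv ℝ l.2 φ x = 0 := by
            have hsup : tsupport φ ⊆ K :=
              closure_minimal (fun y hy => by
                by_contra hyK
                exact hy (f.zero_on_compl hyK)) K.isCompact.isClosed
            exact Function.notMem_support.1 fun h =>
              hx (hsup (support_iteratedFDeriv_subset (𝕜 := ℝ) l.2 h))
          rw [h0, norm_zero, mul_zero]
          positivity
      refine Seminorm.finset_sup_apply_le (by positivity) fun l hl => (h2 l hl).trans ?_
      refine mul_le_mul_of_nonneg_right ?_ (by positivity)
      exact Finset.single_le_sum (f := fun l : ℕ × ℕ => max R 0 ^ l.1)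
        (fun l _ => by positivity) hl

theorem SymbolEstimates.exists_fourierPairing {n : ℕ} {θ m : ℝ} (hθ : 0 < θ)
    {H : EuclideanSpace ℂ (Fin n) → ℂ} (hH : DifferentiableOn ℂ H (strip n θ))
    (hest : SymbolEstimates θ m H) : ∃ κ : Test n →L[ℂ] ℂ, IsFourierPairing H κ := by
  obtain ⟨C, -, hC⟩ := hest 0
  have hm : multiDeriv 0 H = H := by simp [multiDeriv]
  rw [hm] at hC
  have h0 : (0 : EuclideanSpace ℂ (Fin n)) ∈ strip n θ := fun i => by simpa using hθ
  obtain ⟨L, hL⟩ := exists_pairing_schwartz (u := fun ξ => H (toComplex ξ)) (C := C) (m := m)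
    (by simpa using ContinuousOn.continuous_comp_toComplex_add hH.continuousOn h0)
    (fun ξ => by simpa using hC _ (toComplex_mem_strip hθ ξ))
  obtain ⟨κ, hκ⟩ := exists_distribution_of_schwartz (L ∘L fourierSchwartz n)
  refine ⟨κ, fun f => ?_⟩
  have h := hL (fourierSchwartz n f.toSchwartz)
  simp only [fourierSchwartz_apply] at h
  exact ⟨h.1, (hκ f).trans h.2⟩

/-! ### Multiplication by coordinates as differentiation of the symbol -/

theorem hasLineDerivAt_comp_toComplex {n : ℕ} {θ : ℝ} (hθ : 0 < θ)
    {G : EuclideanSpace ℂ (Fin n) → ℂ} (hG : DifferentiableOn ℂ G (strip n θ)) (i : Fin n)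
    (ξ : EuclideanSpace ℝ (Fin n)) :
    HasLineDerivAt ℝ (fun ξ => G (toComplex ξ)) (partialDeriv i G (toComplex ξ)) ξ
      (EuclideanSpace.single i 1) := by
  have hd : DifferentiableAt ℂ G (toComplex ξ) :=
    hG.differentiableAt ((isOpen_strip n θ).mem_nhds (toComplex_mem_strip hθ ξ))
  have h1 : HasDerivAt (fun t : ℂ => G (toComplex ξ + t • EuclideanSpace.single i 1))
      (partialDeriv i G (toComplex ξ)) ((0 : ℝ) : ℂ) := by
    simpa using! hd.lineDifferentiableAt.hasLineDerivAt
  rw [HasLineDerivAt]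
  have he : toComplex (EuclideanSpace.single i (1 : ℝ)) = EuclideanSpace.single i (1 : ℂ) := by
    ext j
    by_cases h : j = i <;> simp [h]
  simp only [toComplex_add, toComplex_smul, he]
  exact h1.comp_ofReal

/-- Each factor `q i` costs one integration by parts. The induction applies the hypothesis to the
Schwartz function `q i * φ` and then moves the last factor onto the `k`-th derivative of the symbol.
-/
theorem integral_mul_fourier_coord_pow_mul {n : ℕ} {θ m : ℝ} (hθ : 0 < θ)
    {H : EuclideanSpace ℂ (Fin n) → ℂ} (hH : DifferentiableOn ℂ H (strip n θ))
    (hest : SymbolEstimates θ m H) (i : Fin n) (k : ℕ) (φ : 𝓢(EuclideanSpace ℝ (Fin n), ℂ)) :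
    ∫ ξ, H (toComplex ξ) * fourier (fun q => (q i : ℂ) ^ k * φ q) ξ =
      (-Complex.I) ^ k * ∫ ξ, (partialDeriv i)^[k] H (toComplex ξ) * fourier φ ξ := by
  have h0 : (0 : EuclideanSpace ℂ (Fin n)) ∈ strip n θ := fun i => by simpa using hθ
  have hd := differentiableOn_iterate_partialDeriv hH i
  have hcont : ∀ k, Continuous fun ξ => (partialDeriv i)^[k] H (toComplex ξ) := fun k => by
    simpa using ContinuousOn.continuous_comp_toComplex_add (hd k).continuousOn h0
  induction k generalizing φ with
  | zero => simp
  | succ k ih =>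
    have hg : Function.HasTemperateGrowth (fun q : EuclideanSpace ℝ (Fin n) => q i) :=
      (EuclideanSpace.proj (𝕜 := ℝ) i).hasTemperateGrowth
    set ψ : 𝓢(EuclideanSpace ℝ (Fin n), ℂ) := SchwartzMap.smulLeftCLM ℂ (fun q => q i) φ
    have hψ : ⇑ψ = fun q => (q i : ℂ) * φ q := by
      ext q; rw [SchwartzMap.smulLeftCLM_apply_apply hg, Complex.real_smul]
    have h1 := ih ψ
    simp only [hψ, ← mul_assoc, ← pow_succ] at h1
    rw [h1, pow_succ, mul_assoc]
    congr 1
    obtain ⟨C, -, hC⟩ := hest.norm_iterate_partialDeriv_le i k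
    obtain ⟨C', -, hC'⟩ := hest.norm_iterate_partialDeriv_le i (k + 1)
    have h2 := integral_mul_fourier_inner_mul (hcont k)
      (fun ξ => by simpa using hC _ (toComplex_mem_strip hθ ξ)) (hcont (k + 1))
      (fun ξ => by simpa using hC' _ (toComplex_mem_strip hθ ξ))
      (v := EuclideanSpace.single i 1) (fun ξ => by
        rw [Function.iterate_succ_apply']
        exact hasLineDerivAt_comp_toComplex hθ (hd k) i ξ) φ
    simpa [EuclideanSpace.inner_single_right] using h2

/-- The symbol `(-1)ᴺ ∑ᵢ ∂ᵢ²ᴺ H`. -/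
def derivSymbol {n : ℕ} (N : ℕ) (H : EuclideanSpace ℂ (Fin n) → ℂ)
    (ζ : EuclideanSpace ℂ (Fin n)) : ℂ :=
  (-1) ^ N * ∑ i, (partialDeriv i)^[2 * N] H ζ

/-- The polynomial `∑ᵢ pᵢ²ᴺ`. -/
def powSum {n : ℕ} (N : ℕ) (p : EuclideanSpace ℝ (Fin n)) : ℝ := ∑ i, p i ^ (2 * N)

theorem contDiff_powSum {n : ℕ} (N : ℕ) : ContDiff ℝ ∞ (powSum (n := n) N) := by
  unfold powSum
  fun_prop

theorem powSum_pos {n : ℕ} (N : ℕ) {p : EuclideanSpace ℝ (Fin n)} (hp : p ≠ 0) :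
    0 < powSum N p := by
  obtain ⟨i, hi⟩ : ∃ i, p i ≠ 0 := by
    by_contra! h
    exact hp (by ext i; simpa using h i)
  refine Finset.sum_pos' (fun j _ => (even_two_mul N).pow_nonneg _) ⟨i, Finset.mem_univ i, ?_⟩
  exact (even_two_mul N).pow_pos hi

theorem powSum_smul {n : ℕ} (N : ℕ) (t : ℝ) (p : EuclideanSpace ℝ (Fin n)) :
    powSum N (t • p) = t ^ (2 * N) * powSum N p := by
  simp [powSum, mul_pow, Finset.mul_sum]

theorem differentiableOn_derivSymbol {n : ℕ} {θ : ℝ} {H : EuclideanSpace ℂ (Fin n) → ℂ}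
    (hH : DifferentiableOn ℂ H (strip n θ)) (N : ℕ) :
    DifferentiableOn ℂ (derivSymbol N H) (strip n θ) := by
  unfold derivSymbol
  exact (DifferentiableOn.fun_sum fun i _ =>
    differentiableOn_iterate_partialDeriv hH i (2 * N)).const_mul _

theorem SymbolEstimates.norm_derivSymbol_le {n : ℕ} {θ m : ℝ}
    {H : EuclideanSpace ℂ (Fin n) → ℂ} (hest : SymbolEstimates θ m H) (N : ℕ) :
    ∃ C : ℝ, 0 ≤ C ∧ ∀ ζ ∈ strip n θ,
      ‖derivSymbol N H ζ‖ ≤ C * (1 + ‖ζ‖) ^ (-(2 * N - m)) := by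
  choose C hC0 hC using fun i => hest.norm_iterate_partialDeriv_le i (2 * N)
  refine ⟨∑ i, C i, Finset.sum_nonneg fun i _ => (hC0 i).le, fun ζ hζ => ?_⟩
  rw [derivSymbol, norm_mul, norm_pow, norm_neg, norm_one, one_pow, one_mul, Finset.sum_mul]
  refine (norm_sum_le _ _).trans (Finset.sum_le_sum fun i _ => ?_)
  simpa using hC i ζ hζ

/-- The sign in `derivSymbol` is (-i)²ᴺ. With a sum of even pure powers, only pure derivatives of
`H` occur, and the multiplier is still positive off the origin. -/
theorem integral_mul_fourier_powSum_mul {n : ℕ} {θ m : ℝ} (hθ : 0 < θ)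
    {H : EuclideanSpace ℂ (Fin n) → ℂ} (hH : DifferentiableOn ℂ H (strip n θ))
    (hest : SymbolEstimates θ m H) (N : ℕ) (φ : 𝓢(EuclideanSpace ℝ (Fin n), ℂ)) :
    ∫ ξ, H (toComplex ξ) * fourier (fun q => (powSum N q : ℂ) * φ q) ξ =
      ∫ ξ, derivSymbol N H (toComplex ξ) * fourier φ ξ := by
  have h0 : (0 : EuclideanSpace ℂ (Fin n)) ∈ strip n θ := fun i => by simpa using hθ
  have hg : ∀ i, Function.HasTemperateGrowth (fun q : EuclideanSpace ℝ (Fin n) => q i ^ (2 * N)) :=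
    fun i => (EuclideanSpace.proj (𝕜 := ℝ) i).hasTemperateGrowth.pow _
  set ψ : Fin n → 𝓢(EuclideanSpace ℝ (Fin n), ℂ) := fun i =>
    SchwartzMap.smulLeftCLM ℂ (fun q : EuclideanSpace ℝ (Fin n) => q i ^ (2 * N)) φ
  have hψ : ∀ i, ⇑(ψ i) = fun q => (q i : ℂ) ^ (2 * N) * φ q := by
    intro i; ext q
    rw [SchwartzMap.smulLeftCLM_apply_apply (hg i), Complex.real_smul, Complex.ofReal_pow]
  have hsum : (fun q => (powSum N q : ℂ) * φ q) = ⇑(∑ i, ψ i) := by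
    ext q
    rw [sum_apply]
    simp [hψ, powSum, Finset.sum_mul]
  have hpair : ∀ k i (χ : 𝓢(EuclideanSpace ℝ (Fin n), ℂ)),
      Integrable fun ξ => (partialDeriv i)^[k] H (toComplex ξ) * fourier χ ξ := by
    intro k i χ
    obtain ⟨C, -, hC⟩ := hest.norm_iterate_partialDeriv_le i k
    have hc : Continuous fun ξ => (partialDeriv i)^[k] H (toComplex ξ) := by
      simpa using ContinuousOn.continuous_comp_toComplex_add
        (differentiableOn_iterate_partialDeriv hH i k).continuousOn h0
    obtain ⟨L, hL⟩ := exists_pairing_schwartz hc (C := C) (m := m - k)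
      (fun ξ => by simpa using hC _ (toComplex_mem_strip hθ ξ))
    simpa using (hL (fourierSchwartz n χ)).1
  have hlin : ∀ ξ, fourier (∑ i, ψ i : 𝓢(EuclideanSpace ℝ (Fin n), ℂ)) ξ =
      ∑ i, fourier (ψ i) ξ := by
    intro ξ
    rw [← fourierSchwartz_apply, map_sum, sum_apply]
    simp
  have h1 : ∀ i, Integrable fun ξ => H (toComplex ξ) * fourier (ψ i) ξ := fun i => hpair 0 i (ψ i)
  have h2 := fun i => hpair (2 * N) i φ
  calc ∫ ξ, H (toComplex ξ) * fourier (fun q => (powSum N q : ℂ) * φ q) ξ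
      = ∑ i, ∫ ξ, H (toComplex ξ) * fourier (ψ i) ξ := by
        rw [hsum, ← integral_finsetSum _ fun i _ => h1 i]
        simp only [hlin, Finset.mul_sum]
    _ = (-1) ^ N * ∑ i, ∫ ξ, (partialDeriv i)^[2 * N] H (toComplex ξ) * fourier φ ξ := by
        rw [Finset.mul_sum]
        refine Finset.sum_congr rfl fun i _ => ?_
        rw [hψ, integral_mul_fourier_coord_pow_mul hθ hH hest, pow_mul, neg_sq, Complex.I_sq]
    _ = _ := by
        rw [← integral_finsetSum _ fun i _ => h2 i, ← integral_const_mul]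
        simp only [derivSymbol, Finset.sum_mul, mul_assoc]

/-! ### Uniform bounds on derivatives -/

/-- The derivatives of a function that is smooth away from the origin and transforms by a factor
under dilations are controlled by their values on the unit sphere. -/
theorem exists_norm_iteratedFDeriv_le_of_smul {E V : Type*} [NormedAddCommGroup E]
    [NormedSpace ℝ E] [FiniteDimensional ℝ E] [NormedAddCommGroup V] [NormedSpace ℝ V]
    {f : E → V} (hf : ContDiffOn ℝ ∞ f {0}ᶜ) {c : ℝ → ℝ}
    (hc : ∀ t, 0 < t → ∀ x, f (t • x) = c t • f x) (j : ℕ) :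
    ∃ M : ℝ, 0 ≤ M ∧ ∀ x, x ≠ 0 → ‖x‖ ^ j * ‖iteratedFDeriv ℝ j f x‖ ≤ |c ‖x‖| * M := by
  have hU : IsOpen ({0}ᶜ : Set E) := isOpen_compl_singleton
  have : ProperSpace E := FiniteDimensional.proper ℝ E
  have hcont : ContinuousOn (iteratedFDeriv ℝ j f) (sphere 0 1) := by
    refine ((hf.continuousOn_iteratedFDerivWithin (m := j) (by exact_mod_cast le_top)
      hU.uniqueDiffOn).congr fun x hx => (iteratedFDerivWithin_of_isOpen j hU hx).symm).mono ?_
    intro x hx h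
    simp [Set.mem_singleton_iff.1 h] at hx
  obtain ⟨M, hM⟩ := (isCompact_sphere (0 : E) 1).exists_bound_of_continuousOn hcont
  refine ⟨max M 0, le_max_right _ _, fun x hx => ?_⟩
  have ht : 0 < ‖x‖ := norm_pos_iff.2 hx
  set t := ‖x‖ with ht'
  set y := t⁻¹ • x with hy
  have hxy : x = t • y := by rw [hy, smul_smul, mul_inv_cancel₀ ht.ne', one_smul]
  have hys : y ∈ sphere (0 : E) 1 := by
    rw [mem_sphere_zero_iff_norm, hy, norm_smul, norm_inv, norm_norm, inv_mul_cancel₀ ht.ne']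
  have hy0 : y ≠ 0 := by
    rintro h; rw [h] at hxy; exact hx (by simpa using hxy)
  let e : E ≃L[ℝ] E := ContinuousLinearEquiv.smulLeft (Units.mk0 t ht.ne')
  have he : ∀ z, e z = t • z := fun z => rfl
  -- The derivative of `f ∘ e` at the unit vector `y` is computed twice: the chain rule gives the
  -- factor `t ^ j` at `x`, the scaling law gives the factor `c t` at `y`.
  have h1 : iteratedFDeriv ℝ j (f ∘ e) y =
      (iteratedFDeriv ℝ j f x).compContinuousLinearMap fun _ => (e : E →L[ℝ] E) := by
    have := e.iteratedFDerivWithin_comp_right f (s := Set.univ) uniqueDiffOn_univ (x := y)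
      (Set.mem_univ _) j
    simpa [iteratedFDerivWithin_univ, he, ← hxy] using this
  have h2 : iteratedFDeriv ℝ j (f ∘ e) y = c t • iteratedFDeriv ℝ j f y := by
    have h3 : f ∘ e = c t • f := by
      ext z; simp [he, hc t ht]
    rw [h3, iteratedFDeriv_const_smul_apply]
    exact (hf.contDiffAt (hU.mem_nhds hy0)).of_le (by exact_mod_cast le_top)
  have h4 : (iteratedFDeriv ℝ j f x).compContinuousLinearMap (fun _ => (e : E →L[ℝ] E)) =
      t ^ j • iteratedFDeriv ℝ j f x := by
    ext v
    simp only [ContinuousMultilinearMap.compContinuousLinearMap_apply,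
      ContinuousLinearEquiv.coe_coe, he, smul_apply]
    rw [ContinuousMultilinearMap.map_smul_univ]
    simp
  have h5 := congrArg norm (h4.symm.trans (h1.symm.trans h2))
  rw [norm_smul, norm_smul, norm_pow, Real.norm_of_nonneg ht.le, Real.norm_eq_abs] at h5
  rw [h5]
  exact mul_le_mul_of_nonneg_left ((hM y hys).trans (le_max_left _ _)) (abs_nonneg _)

theorem norm_iteratedFDeriv_mul_le_of_isOpen {E : Type*} [NormedAddCommGroup E] [NormedSpace ℝ E]
    {f g : E → ℂ} {U : Set E} (hU : IsOpen U) {x : E} (hx : x ∈ U) {j : ℕ}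
    (hf : ContDiffOn ℝ j f U) (hg : ContDiffOn ℝ j g U) {A B : ℝ}
    (hA : ∀ i ≤ j, ‖iteratedFDeriv ℝ i f x‖ ≤ A) (hB : ∀ i ≤ j, ‖iteratedFDeriv ℝ i g x‖ ≤ B) :
    ∀ i ≤ j, ‖iteratedFDeriv ℝ i (fun y => f y * g y) x‖ ≤ 2 ^ j * A * B := by
  intro i hi
  have hA0 : 0 ≤ A := (norm_nonneg _).trans (hA 0 (Nat.zero_le _))
  have hB0 : 0 ≤ B := (norm_nonneg _).trans (hB 0 (Nat.zero_le _))
  have h := norm_iteratedFDerivWithin_mul_le hf hg hU.uniqueDiffOn hx (n := i)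
    (by exact_mod_cast hi)
  simp only [iteratedFDerivWithin_of_isOpen _ hU hx] at h
  refine h.trans ?_
  calc _ ≤ ∑ l ∈ Finset.range (i + 1), (i.choose l : ℝ) * A * B := by
        refine Finset.sum_le_sum fun l hl => ?_
        have hl' : l ≤ i := Nat.lt_succ_iff.1 (Finset.mem_range.1 hl)
        gcongr
        · exact hA l (hl'.trans hi)
        · exact hB _ ((Nat.sub_le _ _).trans hi)
    _ = 2 ^ i * A * B := by
        rw [← Finset.sum_mul, ← Finset.sum_mul]
        congr 2
        exact_mod_cast Nat.sum_range_choose i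
    _ ≤ _ := by
        gcongr
        norm_num

theorem norm_iteratedFDeriv_succ_clm_le {E : Type*} [NormedAddCommGroup E] [NormedSpace ℝ E]
    (L : E →L[ℝ] ℝ) (i : ℕ) (x : E) : ‖iteratedFDeriv ℝ (i + 1) L x‖ ≤ ‖L‖ := by
  rw [← norm_iteratedFDeriv_fderiv]
  have : fderiv ℝ L = fun _ => L := by ext1 y; exact L.fderiv
  rw [this]
  cases i with
  | zero => simp
  | succ i => rw [iteratedFDeriv_const_of_ne (by omega)]; simp

theorem norm_iteratedFDeriv_ofReal_exp (i : ℕ) (t : ℝ) :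
    ‖iteratedFDeriv ℝ i (fun s : ℝ => (Real.exp s : ℂ)) t‖ = Real.exp t := by
  have h := Complex.ofRealLI.norm_iteratedFDeriv_comp_left (f := Real.exp) (x := t)
    Real.contDiff_exp.contDiffAt (i := i) (n := i) le_rfl
  have h2 : (fun s : ℝ => (Real.exp s : ℂ)) = Complex.ofRealLI ∘ Real.exp := rfl
  rw [h2, h, norm_iteratedFDeriv_eq_norm_iteratedDeriv, iteratedDeriv_eq_iterate,
    Real.iter_deriv_exp, Real.norm_of_nonneg (Real.exp_pos t).le]

/-- Near `p`, the ratio of `e^{ε|·|}` to the exponential of its linearization at `p` has bounded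
derivatives, uniformly in `p` away from the origin. -/
theorem exists_norm_iteratedFDeriv_exp_le {E : Type*} [NormedAddCommGroup E]
    [InnerProductSpace ℝ E] [FiniteDimensional ℝ E] {ε : ℝ} (hε : 0 < ε) (j : ℕ) :
    ∃ A : ℝ, ∀ p : E, 1 / 2 ≤ ‖p‖ → ∀ i ≤ j, ‖iteratedFDeriv ℝ i
      (fun q : E => (Real.exp (ε * ‖q‖ - inner ℝ ((ε / ‖p‖) • p) q) : ℂ)) p‖ ≤ A := by
  have hn : ContDiffOn ℝ ∞ (fun q : E => ‖q‖) {0}ᶜ :=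
    contDiffOn_id.norm ℝ fun q hq => hq
  choose M hM0 hM using exists_norm_iteratedFDeriv_le_of_smul hn (c := fun t => t)
    (fun t ht x => by rw [norm_smul, Real.norm_of_nonneg ht.le, smul_eq_mul])
  -- One constant for all orders up to `j`: the powers of 2 come from `‖p‖ ≥ 1 / 2`, the extra `ε`
  -- bounds the linear part, and the leading 1 ensures `D ≤ D ^ l`.
  set D : ℝ := 1 + ∑ i ∈ Finset.range (j + 1), (ε * (2 ^ i * M i) + ε) with hD
  have hterm : ∀ i, 0 ≤ ε * (2 ^ i * M i) + ε := fun i => by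
    have := hM0 i; positivity
  have hD1 : 1 ≤ D := by
    have := Finset.sum_nonneg fun i (_ : i ∈ Finset.range (j + 1)) => hterm i
    linarith
  have hU : IsOpen ({0}ᶜ : Set E) := isOpen_compl_singleton
  refine ⟨j.factorial * 1 * D ^ j, fun p hp i hi => ?_⟩
  have hp0 : 0 < ‖p‖ := by linarith
  have hpU : p ∈ ({0}ᶜ : Set E) := norm_pos_iff.1 hp0
  set L : E →L[ℝ] ℝ := innerSL ℝ ((ε / ‖p‖) • p) with hL
  have hLn : ‖L‖ = ε := by
    rw [hL, innerSL_apply_norm, norm_smul, norm_div, norm_norm, Real.norm_of_nonneg hε.le,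
      div_mul_cancel₀ _ hp0.ne']
  -- The exponent vanishes at `p`, so every derivative of the outer exponential has norm 1 there,
  -- whatever the size of `p`.
  have hLp : L p = ε * ‖p‖ := by
    rw [hL, innerSL_apply_apply, inner_smul_left, real_inner_self_eq_norm_sq]
    simp; field_simp
  have hφ : ContDiffOn ℝ ∞ (fun q : E => ε • ‖q‖ - L q) {0}ᶜ :=
    (hn.const_smul ε).sub L.contDiff.contDiffOn
  have hbd : ∀ l, 1 ≤ l → l ≤ i →
      ‖iteratedFDeriv ℝ l (fun q : E => ε • ‖q‖ - L q) p‖ ≤ D ^ l := by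
    intro l hl hli
    have hnp : ContDiffAt ℝ l (fun q : E => ‖q‖) p :=
      (hn.contDiffAt (hU.mem_nhds hpU)).of_le (by exact_mod_cast le_top)
    have h1 : iteratedFDeriv ℝ l (fun q : E => ε • ‖q‖ - L q) p =
        ε • iteratedFDeriv ℝ l (fun q : E => ‖q‖) p - iteratedFDeriv ℝ l L p := by
      rw [← iteratedFDeriv_const_smul_apply hnp]
      exact iteratedFDeriv_sub_apply (hnp.const_smul ε) L.contDiff.contDiffAt
    obtain ⟨l, rfl⟩ := Nat.exists_eq_add_of_le' hl
    have h2 := norm_iteratedFDeriv_succ_clm_le L l p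
    have h3 : ‖iteratedFDeriv ℝ (l + 1) (fun q : E => ‖q‖) p‖ ≤ 2 ^ (l + 1) * M (l + 1) := by
      have h4 := hM (l + 1) p hpU
      rw [abs_norm, pow_succ', mul_assoc] at h4
      have h5 := le_of_mul_le_mul_left h4 hp0
      have h6 : (1 / 2 : ℝ) ^ l ≤ ‖p‖ ^ l := pow_le_pow_left₀ (by norm_num) hp l
      have h7 : (2 : ℝ) ^ l * (1 / 2) ^ l = 1 := by rw [← mul_pow]; norm_num
      have h8 := norm_nonneg (iteratedFDeriv ℝ (l + 1) (fun q : E => ‖q‖) p)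
      calc _ = 2 ^ l * ((1 / 2) ^ l * ‖iteratedFDeriv ℝ (l + 1) (fun q : E => ‖q‖) p‖) := by
            rw [← mul_assoc, h7, one_mul]
        _ ≤ 2 ^ l * (‖p‖ ^ l * ‖iteratedFDeriv ℝ (l + 1) (fun q : E => ‖q‖) p‖) := by gcongr
        _ ≤ 2 ^ l * M (l + 1) := by gcongr
        _ ≤ _ := by
          refine mul_le_mul_of_nonneg_right ?_ (hM0 _)
          exact pow_le_pow_right₀ (by norm_num) (Nat.le_succ l)
    have h9 : ε * (2 ^ (l + 1) * M (l + 1)) + ε ≤ D := by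
      have := Finset.single_le_sum (f := fun i => ε * (2 ^ i * M i) + ε) (fun i _ => hterm i)
        (Finset.mem_range.2 (show l + 1 < j + 1 by omega))
      linarith
    calc _ ≤ ε * (2 ^ (l + 1) * M (l + 1)) + ε := by
          rw [h1]
          refine (norm_sub_le _ _).trans (add_le_add ?_ (h2.trans hLn.le))
          rw [norm_smul, Real.norm_of_nonneg hε.le]
          gcongr
      _ ≤ D := h9
      _ ≤ D ^ (l + 1) := le_self_pow₀ hD1 (by omega)
  have h := norm_iteratedFDerivWithin_comp_le (n := i) (N := i)
    (g := fun s : ℝ => (Real.exp s : ℂ)) (t := Set.univ) (s := ({0}ᶜ : Set E)) (x := p)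
    (Complex.ofRealCLM.contDiff.comp Real.contDiff_exp).contDiffOn
    (hφ.of_le (by exact_mod_cast le_top)) le_rfl uniqueDiffOn_univ hU.uniqueDiffOn
    (Set.mapsTo_univ _ _) hpU (C := 1) (D := D) (fun l _ => by
      rw [iteratedFDerivWithin_univ, norm_iteratedFDeriv_ofReal_exp, hLp]; simp)
    (fun l hl hli => by rw [iteratedFDerivWithin_of_isOpen _ hU hpU]; exact hbd l hl hli)
  rw [iteratedFDerivWithin_of_isOpen _ hU hpU] at h
  refine h.trans ?_
  have hf : (i.factorial : ℝ) ≤ j.factorial := by exact_mod_cast Nat.factorial_le hi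
  gcongr

theorem exists_norm_iteratedFDeriv_bump_le {E : Type*} [NormedAddCommGroup E]
    [InnerProductSpace ℝ E] [FiniteDimensional ℝ E] (b : ContDiffBump (0 : E)) (i : ℕ) :
    ∃ A : ℝ, ∀ p, ‖iteratedFDeriv ℝ i (fun q => 1 - (b q : ℂ)) p‖ ≤ A := by
  have hb : ContDiff ℝ ∞ (fun q => (b q : ℂ)) := Complex.ofRealCLM.contDiff.comp b.contDiff
  have hbc : HasCompactSupport (fun q => (b q : ℂ)) :=
    b.hasCompactSupport.comp_left (g := fun x : ℝ => (x : ℂ)) Complex.ofReal_zero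
  obtain ⟨A, hA⟩ := (hbc.iteratedFDeriv (𝕜 := ℝ) i).exists_bound_of_continuous
    (hb.continuous_iteratedFDeriv (m := i) (by exact_mod_cast le_top))
  refine ⟨1 + A, fun p => ?_⟩
  have h : iteratedFDeriv ℝ i (fun q => 1 - (b q : ℂ)) p =
      iteratedFDeriv ℝ i (fun _ => (1 : ℂ)) p - iteratedFDeriv ℝ i (fun q => (b q : ℂ)) p :=
    iteratedFDeriv_sub_apply contDiffAt_const (hb.contDiffAt.of_le (by exact_mod_cast le_top))
  rw [h]
  refine (norm_sub_le _ _).trans (add_le_add ?_ (hA p))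
  cases i with
  | zero => simp
  | succ i => rw [iteratedFDeriv_const_of_ne (by omega)]; simp

theorem integrable_norm_pow_mul {n i j : ℕ} {u : EuclideanSpace ℝ (Fin n) → ℂ} {A s : ℝ}
    (hs : (n : ℝ) + j < s) (hij : i ≤ j) (hu : Continuous u)
    (hA : ∀ ξ, ‖u ξ‖ ≤ A * (1 + ‖ξ‖) ^ (-s)) :
    Integrable (fun ξ => ‖ξ‖ ^ i * ‖u ξ‖) ∧ ∫ ξ, ‖ξ‖ ^ i * ‖u ξ‖ ≤
      A * ∫ ξ : EuclideanSpace ℝ (Fin n), (1 + ‖ξ‖) ^ (-(s - j)) := by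
  have hb : ∀ ξ, ‖ξ‖ ^ i * ‖u ξ‖ ≤ A * (1 + ‖ξ‖) ^ (-(s - j)) := by
    intro ξ
    have h1 : ‖ξ‖ ^ i ≤ (1 + ‖ξ‖) ^ j :=
      (pow_le_pow_left₀ (norm_nonneg _) (by linarith) i).trans
        (pow_le_pow_right₀ (by linarith [norm_nonneg ξ]) hij)
    calc ‖ξ‖ ^ i * ‖u ξ‖ ≤ (1 + ‖ξ‖) ^ j * (A * (1 + ‖ξ‖) ^ (-s)) :=
          mul_le_mul h1 (hA ξ) (norm_nonneg _) (by positivity)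
      _ = A * ((1 + ‖ξ‖) ^ (-s) * (1 + ‖ξ‖) ^ j) := by ring
      _ = _ := by
        rw [← Real.rpow_natCast, ← Real.rpow_add (by positivity)]
        congr 2; ring
  have hI := (integrable_one_add_norm (μ := (volume : Measure (EuclideanSpace ℝ (Fin n))))
    (r := s - j) (by rw [finrank_euclideanSpace_fin]; linarith)).const_mul A
  have hI' : Integrable (fun ξ => ‖ξ‖ ^ i * ‖u ξ‖) :=
    hI.mono' (Continuous.aestronglyMeasurable (by fun_prop)) (Eventually.of_forall fun ξ => by
      rw [Real.norm_of_nonneg (by positivity)]; exact hb ξ)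
  refine ⟨hI', ?_⟩
  rw [← integral_const_mul]
  exact integral_mono hI' hI hb

/-! ### The kernel off the origin -/

/-- The function equal to the distribution away from the origin, for `N` large. -/
def kernel {n : ℕ} (N : ℕ) (H : EuclideanSpace ℂ (Fin n) → ℂ) (p : EuclideanSpace ℝ (Fin n)) : ℂ :=
  (powSum N p : ℂ)⁻¹ * fourier (fun ξ => derivSymbol N H (toComplex ξ)) p

variable {n : ℕ} {θ m : ℝ} {H : EuclideanSpace ℂ (Fin n) → ℂ}

theorem continuous_derivSymbol_comp (hH : DifferentiableOn ℂ H (strip n θ)) (N : ℕ)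
    {ζ : EuclideanSpace ℂ (Fin n)} (hζ : ζ ∈ strip n θ) :
    Continuous fun ξ => derivSymbol N H (toComplex ξ + ζ) :=
  ContinuousOn.continuous_comp_toComplex_add (differentiableOn_derivSymbol hH N).continuousOn hζ

theorem zero_mem_strip (hθ : 0 < θ) : (0 : EuclideanSpace ℂ (Fin n)) ∈ strip n θ :=
  fun i => by simpa using hθ

theorem contDiffOn_inv_powSum (N : ℕ) :
    ContDiffOn ℝ ∞ (fun p : EuclideanSpace ℝ (Fin n) => (powSum N p : ℂ)⁻¹) {0}ᶜ := by
  refine ContDiffOn.inv (Complex.ofRealCLM.contDiff.comp (contDiff_powSum N)).contDiffOn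
    fun p hp => ?_
  simpa using (powSum_pos N hp).ne'

theorem contDiffOn_kernel (hθ : 0 < θ) (hH : DifferentiableOn ℂ H (strip n θ))
    (hest : SymbolEstimates θ m H) {N j : ℕ} (hN : (n : ℝ) + j < 2 * N - m) :
    ContDiffOn ℝ j (kernel N H) {0}ᶜ := by
  obtain ⟨C, -, hC⟩ := hest.norm_derivSymbol_le N
  refine ((contDiffOn_inv_powSum N).of_le (by exact_mod_cast le_top)).mul
    (contDiff_fourier fun i hi => ?_).contDiffOn
  exact (integrable_norm_pow_mul hN hi
    (by simpa using continuous_derivSymbol_comp hH N (zero_mem_strip hθ))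
    (fun ξ => by simpa using hC _ (toComplex_mem_strip hθ ξ))).1

/-- Since `f` vanishes near the origin, `f` divided by `powSum N` is again smooth with compact
support, and the multiplication formula applies to this quotient. -/
theorem IsFourierPairing.eq_integral_kernel (hθ : 0 < θ) (hH : DifferentiableOn ℂ H (strip n θ))
    (hest : SymbolEstimates θ m H) {κ : Test n →L[ℂ] ℂ} (hκ : IsFourierPairing H κ) {N : ℕ}
    (hN : (n : ℝ) < 2 * N - m) (f : Test n) (hf : tsupport f ⊆ {0}ᶜ) :
    κ f = ∫ p, kernel N H p * f p := by
  have hf0 : f =ᶠ[𝓝 0] 0 :=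
    notMem_tsupport_iff_eventuallyEq.1 fun h => hf h rfl
  have hsm : ContDiff ℝ ∞ (fun p => (powSum N p : ℂ)⁻¹ * f p) := by
    rw [contDiff_iff_contDiffAt]
    intro p
    by_cases hp : p = 0
    · subst hp
      refine (contDiffAt_const (c := (0 : ℂ))).congr_of_eventuallyEq ?_
      filter_upwards [hf0] with q hq
      simp [hq]
    · exact ((contDiffOn_inv_powSum N).contDiffAt
        (isOpen_compl_singleton.mem_nhds hp)).mul f.contDiff.contDiffAt
  have hcs : HasCompactSupport (fun p => (powSum N p : ℂ)⁻¹ * f p) :=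
    f.hasCompactSupport.mul_left
  set φ := hcs.toSchwartzMap hsm
  have hφ : ⇑φ = fun p => (powSum N p : ℂ)⁻¹ * f p := rfl
  have hfφ : ⇑f = fun p => (powSum N p : ℂ) * φ p := by
    ext p
    rw [hφ]
    by_cases hp : p = 0
    · subst hp; simp [hf0.eq_of_nhds]
    · rw [mul_inv_cancel_left₀]
      exact_mod_cast (powSum_pos N hp).ne'
  obtain ⟨C, -, hC⟩ := hest.norm_derivSymbol_le N
  have hu : Integrable fun ξ => derivSymbol N H (toComplex ξ) :=
    integrable_of_continuous_of_le hN
      (by simpa using continuous_derivSymbol_comp hH N (zero_mem_strip hθ))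
      (fun ξ => by simpa using hC _ (toComplex_mem_strip hθ ξ))
  rw [(hκ f).2, hfφ, integral_mul_fourier_powSum_mul hθ hH hest,
    integral_mul_fourier_comm hu φ.integrable, ← hfφ, hφ]
  congr 1; ext p
  rw [kernel]; ring

/-- Both kernels represent the same distribution, so they agree almost everywhere off the origin,
and by continuity everywhere there. -/
theorem kernel_eqOn_kernel (hθ : 0 < θ) (hH : DifferentiableOn ℂ H (strip n θ))
    (hest : SymbolEstimates θ m H) {N M : ℕ} (hN : (n : ℝ) < 2 * N - m)
    (hM : (n : ℝ) < 2 * M - m) : Set.EqOn (kernel N H) (kernel M H) {0}ᶜ := by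
  obtain ⟨κ, hκ⟩ := hest.exists_fourierPairing hθ hH
  have hcN : ContinuousOn (kernel N H) {0}ᶜ :=
    (contDiffOn_kernel hθ hH hest (j := 0) (by simpa using hN)).continuousOn
  have hcM : ContinuousOn (kernel M H) {0}ᶜ :=
    (contDiffOn_kernel hθ hH hest (j := 0) (by simpa using hM)).continuousOn
  have hU : IsOpen ({0}ᶜ : Set (EuclideanSpace ℝ (Fin n))) := isOpen_compl_singleton
  have hint : ∀ k : EuclideanSpace ℝ (Fin n) → ℂ, ContinuousOn k {0}ᶜ →
      ∀ g : EuclideanSpace ℝ (Fin n) → ℝ, Continuous g → HasCompactSupport g →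
      tsupport g ⊆ {0}ᶜ → Integrable fun p => k p * (g p : ℂ) := by
    intro k hk g hg hgc hgs
    have hc : Continuous fun p => k p * (g p : ℂ) := by
      rw [continuous_iff_continuousAt]
      intro p
      by_cases hp : p ∈ tsupport g
      · exact (hk.continuousAt (hU.mem_nhds (hgs hp))).mul
          (Complex.continuous_ofReal.comp hg).continuousAt
      · refine (continuousAt_const (y := (0 : ℂ))).congr ?_
        filter_upwards [notMem_tsupport_iff_eventuallyEq.1 hp] with q hq
        simp [hq]
    refine hc.integrable_of_hasCompactSupport (HasCompactSupport.mul_left ?_)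
    exact hgc.comp_left (g := fun x : ℝ => (x : ℂ)) Complex.ofReal_zero
  have hae := hU.ae_eq_zero_of_integral_contDiff_smul_eq_zero (μ := volume)
    (f := fun p => kernel N H p - kernel M H p)
    ((hcN.sub hcM).locallyIntegrableOn hU.measurableSet) (fun g hg hgc hgs => by
      let f : Test n := ⟨fun p => (g p : ℂ), Complex.ofRealCLM.contDiff.comp hg,
        hgc.comp_left (g := fun x : ℝ => (x : ℂ)) Complex.ofReal_zero, Set.subset_univ _⟩
      have hf : tsupport f ⊆ {0}ᶜ := by
        refine (closure_mono fun p hp => ?_).trans hgs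
        intro h
        exact hp (by change ((g p : ℝ) : ℂ) = 0; rw [h]; simp)
      have h1 := hκ.eq_integral_kernel hθ hH hest hN f hf
      have h2 := hκ.eq_integral_kernel hθ hH hest hM f hf
      have h3 := integral_sub (hint _ hcN g hg.continuous hgc hgs)
        (hint _ hcM g hg.continuous hgc hgs)
      rw [h1] at h2
      have h4 : ∫ p, kernel N H p * (g p : ℂ) = ∫ p, kernel M H p * (g p : ℂ) := h2
      rw [h4, sub_self] at h3
      rw [← h3]
      congr 1; ext p
      rw [Complex.real_smul]; ring)
  have hres : kernel N H =ᵐ[volume.restrict {0}ᶜ] kernel M H := by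
    rw [Filter.EventuallyEq, ae_restrict_iff' hU.measurableSet]
    filter_upwards [hae] with p hp h
    exact sub_eq_zero.1 (hp h)
  exact Measure.eqOn_open_of_ae_eq hres hU hcN hcM

/-! ### Exponential decay -/

theorem smul_toComplex_mem_strip {η : EuclideanSpace ℝ (Fin n)} (hη : ‖η‖ < θ) :
    Complex.I • toComplex (-η) ∈ strip n θ := by
  intro i
  simpa using (PiLp.norm_apply_le η i).trans_lt hη

/-- On ℝⁿ - iη the factor exp(-i⟨ζ, p⟩) equals exp(-⟨η, p⟩) exp(-i⟨ξ, p⟩). -/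
theorem fourier_derivSymbol_eq_exp_mul (hH : DifferentiableOn ℂ H (strip n θ))
    (hest : SymbolEstimates θ m H) {N : ℕ} (hN : (n : ℝ) < 2 * N - m)
    {η : EuclideanSpace ℝ (Fin n)} (hη : ‖η‖ < θ) (p : EuclideanSpace ℝ (Fin n)) :
    fourier (fun ξ => derivSymbol N H (toComplex ξ)) p = (Real.exp (-inner ℝ η p) : ℂ) *
      fourier (fun ξ => derivSymbol N H (toComplex ξ + Complex.I • toComplex (-η))) p := by
  obtain ⟨C, hC0, hC⟩ := hest.norm_derivSymbol_le N
  set K : EuclideanSpace ℂ (Fin n) → ℂ := fun ζ =>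
    Complex.exp (-(Complex.I * ∑ i, ζ i * (p i : ℂ))) * derivSymbol N H ζ with hK
  have hKd : DifferentiableOn ℂ K (strip n θ) := by
    refine DifferentiableOn.mul (Differentiable.differentiableOn ?_)
      (differentiableOn_derivSymbol hH N)
    fun_prop
  -- The exponential is bounded on the strip because imaginary parts are. The constant depends on
  -- `p`, which is harmless: it only justifies the shift.
  have hKC : ∀ ζ ∈ strip n θ,
      ‖K ζ‖ ≤ (Real.exp (∑ i, θ * |p i|) * C) * (1 + ‖ζ‖) ^ (-(2 * N - m)) := by
    intro ζ hζ
    rw [hK, norm_mul, mul_assoc]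
    refine mul_le_mul ?_ (hC ζ hζ) (norm_nonneg _) (Real.exp_pos _).le
    rw [Complex.norm_exp]
    refine Real.exp_le_exp.2 ?_
    have : (-(Complex.I * ∑ i, ζ i * (p i : ℂ))).re = ∑ i, (ζ i).im * p i := by
      simp [Complex.im_sum]
    rw [this]
    refine Finset.sum_le_sum fun i _ => (le_abs_self _).trans ?_
    rw [abs_mul]
    exact mul_le_mul_of_nonneg_right (hζ i).le (abs_nonneg _)
  have h := integral_toComplex_eq_integral_add hKd hN hKC (η := -η) (fun i => by
    simpa using (PiLp.norm_apply_le η i).trans_lt hη)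
  have hinner : ∀ ξ : EuclideanSpace ℝ (Fin n), ((inner ℝ ξ p : ℝ) : ℂ) = ∑ i, (ξ i : ℂ) * p i := by
    intro ξ
    simp [PiLp.inner_apply, mul_comm]
  have hl : fourier (fun ξ => derivSymbol N H (toComplex ξ)) p = ∫ ξ, K (toComplex ξ) := by
    rw [fourier]
    simp only [hK, toComplex_apply, hinner]
  rw [hl, h, fourier, ← integral_const_mul]
  congr 1
  ext ξ
  simp only [hK]
  rw [← mul_assoc, Complex.ofReal_exp, ← Complex.exp_add]
  congr 2
  push_cast
  simp only [hinner, PiLp.add_apply, PiLp.smul_apply, toComplex_apply, PiLp.neg_apply, add_mul,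
    Finset.sum_add_distrib, smul_eq_mul, mul_assoc, mul_add, ← Finset.mul_sum, Complex.ofReal_neg,
    neg_mul, Finset.sum_neg_distrib]
  linear_combination (∑ i, (η i : ℂ) * p i) * Complex.I_mul_I

theorem exists_norm_iteratedFDeriv_fourier_shift_le (hH : DifferentiableOn ℂ H (strip n θ))
    (hest : SymbolEstimates θ m H) {N j : ℕ} (hN : (n : ℝ) + j < 2 * N - m) {ε : ℝ}
    (hεθ : ε < θ) :
    ∃ A : ℝ, ∀ η : EuclideanSpace ℝ (Fin n), ‖η‖ = ε →
      ContDiff ℝ j (fourier fun ξ => derivSymbol N H (toComplex ξ + Complex.I • toComplex (-η))) ∧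
      ∀ i ≤ j, ∀ p, ‖iteratedFDeriv ℝ i (fourier fun ξ =>
        derivSymbol N H (toComplex ξ + Complex.I • toComplex (-η))) p‖ ≤ A := by
  obtain ⟨C, hC0, hC⟩ := hest.norm_derivSymbol_le N
  set s : ℝ := 2 * N - m
  have hs0 : 0 ≤ s := by
    have : (0 : ℝ) ≤ n + j := by positivity
    linarith
  set J : ℝ := ∫ ξ : EuclideanSpace ℝ (Fin n), (1 + ‖ξ‖) ^ (-(s - j))
  have hJ : 0 ≤ J := integral_nonneg fun ξ => by positivity
  set c : ℝ := 2 * Real.pi * ‖fourierForm n‖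
  have hc : 0 ≤ c := by positivity
  -- The power of `1 + c` dominates `c ^ i` for all `i ≤ j`. The power of `1 + ε` is the cost in
  -- Peetre's inequality of a shift of length `ε`, so the bound does not depend on the direction of
  -- `η`.
  refine ⟨(1 + c) ^ j * (C * (1 + ε) ^ s * J), fun η hη => ?_⟩
  have hε : 0 ≤ ε := hη ▸ norm_nonneg η
  have hmem := smul_toComplex_mem_strip (θ := θ) (η := η) (by linarith)
  set u : EuclideanSpace ℝ (Fin n) → ℂ := fun ξ =>
    derivSymbol N H (toComplex ξ + Complex.I • toComplex (-η)) with hu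
  have hcont : Continuous u := continuous_derivSymbol_comp hH N hmem
  have hbound : ∀ ξ, ‖u ξ‖ ≤ (C * (1 + ε) ^ s) * (1 + ‖ξ‖) ^ (-s) := by
    intro ξ
    refine (hC _ (toComplex_add_mem_strip ξ hmem)).trans ?_
    rw [mul_assoc]
    refine mul_le_mul_of_nonneg_left ?_ hC0
    have := one_add_norm_rpow_neg_le (x := toComplex ξ) (y := Complex.I • toComplex (-η))
      (R := ε) hs0 (by rw [norm_smul, norm_toComplex, norm_neg, hη]; simp)
    simpa using this
  refine ⟨contDiff_fourier fun i hi => (integrable_norm_pow_mul hN hi hcont hbound).1,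
    fun i hi p => ?_⟩
  refine (norm_iteratedFDeriv_fourier_le hcont.aestronglyMeasurable
    (fun l hl => (integrable_norm_pow_mul hN (hl.trans hi) hcont hbound).1) p).trans ?_
  refine mul_le_mul ?_ (integrable_norm_pow_mul hN hi hcont hbound).2
    (integral_nonneg fun ξ => by positivity) (by positivity)
  exact (pow_le_pow_left₀ hc (by linarith) i).trans (pow_le_pow_right₀ (by linarith) hi)

/-- The function is homogeneous of degree `-2 * N`, so its derivatives stay bounded away from the
origin. -/
theorem exists_norm_iteratedFDeriv_inv_powSum_le (N j : ℕ) :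
    ∃ A : ℝ, ∀ p : EuclideanSpace ℝ (Fin n), 1 / 2 ≤ ‖p‖ → ∀ i ≤ j,
      ‖iteratedFDeriv ℝ i (fun q => (powSum N q : ℂ)⁻¹) p‖ ≤ A := by
  choose M hM0 hM using exists_norm_iteratedFDeriv_le_of_smul
    (contDiffOn_inv_powSum (n := n) N) (c := fun t => (t ^ (2 * N))⁻¹)
    (fun t _ x => by rw [powSum_smul, Complex.real_smul]; push_cast; rw [mul_inv])
  refine ⟨∑ i ∈ Finset.range (j + 1), 2 ^ (2 * N + i) * M i, fun p hp i hi => ?_⟩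
  have hp0 : 0 < ‖p‖ := by linarith
  have h := hM i p (norm_pos_iff.1 hp0)
  set X := ‖iteratedFDeriv ℝ i (fun q : EuclideanSpace ℝ (Fin n) => (powSum N q : ℂ)⁻¹) p‖
  have h1 : ‖p‖ ^ (2 * N + i) * X ≤ M i := by
    rw [abs_of_nonneg (by positivity), le_inv_mul_iff₀ (by positivity)] at h
    rw [pow_add, mul_assoc]; exact h
  have h2 : (1 / 2 : ℝ) ^ (2 * N + i) ≤ ‖p‖ ^ (2 * N + i) :=
    pow_le_pow_left₀ (by norm_num) hp _
  have h3 : (2 : ℝ) ^ (2 * N + i) * (1 / 2) ^ (2 * N + i) = 1 := by rw [← mul_pow]; norm_num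
  have hX : 0 ≤ X := norm_nonneg _
  calc X = 2 ^ (2 * N + i) * ((1 / 2) ^ (2 * N + i) * X) := by rw [← mul_assoc, h3, one_mul]
    _ ≤ 2 ^ (2 * N + i) * (‖p‖ ^ (2 * N + i) * X) := by gcongr
    _ ≤ 2 ^ (2 * N + i) * M i := by gcongr
    _ ≤ _ := Finset.single_le_sum (f := fun i => 2 ^ (2 * N + i) * M i)
        (fun i _ => mul_nonneg (by positivity) (hM0 i))
        (Finset.mem_range.2 (Nat.lt_succ_of_le hi))

/-- For regularity of order `j`, `N` is replaced by `N + j`, which does not change the kernel off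
the origin. -/
theorem contDiffOn_infty_kernel (hθ : 0 < θ) (hH : DifferentiableOn ℂ H (strip n θ))
    (hest : SymbolEstimates θ m H) {N : ℕ} (hN : (n : ℝ) < 2 * N - m) :
    ContDiffOn ℝ ∞ (kernel N H) {0}ᶜ := by
  rw [contDiffOn_infty]
  intro j
  have hM : (n : ℝ) + j < 2 * ((N + j : ℕ) : ℝ) - m := by
    push_cast
    linarith [(Nat.cast_nonneg j : (0 : ℝ) ≤ j)]
  have hM' : (n : ℝ) < 2 * ((N + j : ℕ) : ℝ) - m := by
    linarith [(Nat.cast_nonneg j : (0 : ℝ) ≤ j)]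
  exact (contDiffOn_kernel hθ hH hest hM).congr (kernel_eqOn_kernel hθ hH hest hN hM')

theorem exists_smoothBounded_kernel_eq (hθ : 0 < θ) (hH : DifferentiableOn ℂ H (strip n θ))
    (hest : SymbolEstimates θ m H) {N : ℕ} (hN : (n : ℝ) < 2 * N - m) {ε : ℝ} (hε : 0 < ε)
    (hεθ : ε < θ) :
    ∃ F : EuclideanSpace ℝ (Fin n) → ℂ, SmoothBounded F ∧
      ∀ p : EuclideanSpace ℝ (Fin n), 1 < ‖p‖ →
        kernel N H p = (Real.exp (-(ε * ‖p‖)) : ℂ) * F p := by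
  have hU : IsOpen ({0}ᶜ : Set (EuclideanSpace ℝ (Fin n))) := isOpen_compl_singleton
  -- The cutoff `1 - b` vanishes for norm at most 1/2 and equals 1 for norm at least 1.
  let b : ContDiffBump (0 : EuclideanSpace ℝ (Fin n)) := ⟨1 / 2, 1, by norm_num, by norm_num⟩
  have hb : ContDiff ℝ ∞ (fun q => 1 - (b q : ℂ)) :=
    contDiff_const.sub (Complex.ofRealCLM.contDiff.comp b.contDiff)
  set F : EuclideanSpace ℝ (Fin n) → ℂ := fun p =>
    (1 - (b p : ℂ)) * ((Real.exp (ε * ‖p‖) : ℂ) * kernel N H p) with hF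
  have hF0 : ∀ p, ‖p‖ < 1 / 2 → F =ᶠ[𝓝 p] fun _ => 0 := by
    intro p hp
    filter_upwards [isOpen_ball.mem_nhds (mem_ball_zero_iff.2 hp)] with q hq
    have : b q = 1 := b.one_of_mem_closedBall (ball_subset_closedBall hq)
    simp [hF, this]
  have hexp : ContDiffOn ℝ ∞ (fun q : EuclideanSpace ℝ (Fin n) => (Real.exp (ε * ‖q‖) : ℂ)) {0}ᶜ :=
    (Complex.ofRealCLM.contDiff.comp Real.contDiff_exp).comp_contDiffOn
      (contDiffOn_const.mul (contDiffOn_id.norm ℝ fun q hq => hq))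
  refine ⟨F, ⟨?_, fun j => ?_⟩, fun p hp => ?_⟩
  · rw [contDiff_iff_contDiffAt]
    intro p
    by_cases hp : p = 0
    · exact contDiffAt_const.congr_of_eventuallyEq (hF0 p (by simp [hp]))
    · exact (hb.contDiffOn.mul (hexp.mul (contDiffOn_infty_kernel hθ hH hest hN))).contDiffAt
        (hU.mem_nhds hp)
  · set M := N + j with hM
    have hj0 : (0 : ℝ) ≤ j := Nat.cast_nonneg j
    have hMj : (n : ℝ) + j < 2 * (M : ℝ) - m := by
      rw [hM]; push_cast; linarith
    choose A hA using exists_norm_iteratedFDeriv_bump_le b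
    obtain ⟨B, hB⟩ := exists_norm_iteratedFDeriv_inv_powSum_le (n := n) M j
    obtain ⟨D, hD⟩ := exists_norm_iteratedFDeriv_exp_le (E := EuclideanSpace ℝ (Fin n)) hε j
    obtain ⟨G, hG⟩ := exists_norm_iteratedFDeriv_fourier_shift_le hH hest hMj hεθ
    have hA' : ∀ p, ∀ i ≤ j, ‖iteratedFDeriv ℝ i (fun q => 1 - (b q : ℂ)) p‖ ≤
        ∑ l ∈ Finset.range (j + 1), A l := fun p i hi =>
      (hA i p).trans (Finset.single_le_sum (f := A)
        (fun l _ => (norm_nonneg _).trans (hA l 0)) (Finset.mem_range.2 (Nat.lt_succ_of_le hi)))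
    set A' := ∑ l ∈ Finset.range (j + 1), A l
    -- Three applications of the Leibniz bound to a product of four factors; the maximum with 0
    -- covers the ball where `F` vanishes.
    refine ⟨max (2 ^ j * A' * (2 ^ j * B * (2 ^ j * D * G))) 0, fun p => ?_⟩
    rcases lt_or_ge ‖p‖ (1 / 2) with hp | hp
    · rw [((hF0 p hp).iteratedFDeriv ℝ j).eq_of_nhds]
      refine le_max_of_le_right (le_of_eq ?_)
      rw [show (fun _ : EuclideanSpace ℝ (Fin n) => (0 : ℂ)) = 0 from rfl, iteratedFDeriv_zero]
      simp
    · refine le_max_of_le_left ?_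
      have hp0 : 0 < ‖p‖ := by linarith
      have hpU : p ∈ ({0}ᶜ : Set (EuclideanSpace ℝ (Fin n))) := norm_pos_iff.1 hp0
      -- The shift is adapted to `p` and kept fixed while `q` varies near `p`. No derivative falls
      -- on `η`, and the bounds depend only on its norm.
      set η := (ε / ‖p‖) • p with hη
      have hηn : ‖η‖ = ε := by
        rw [hη, norm_smul, norm_div, norm_norm, Real.norm_of_nonneg hε.le,
          div_mul_cancel₀ _ hp0.ne']
      obtain ⟨hGc, hGb⟩ := hG η hηn
      set g := fourier fun ξ => derivSymbol M H (toComplex ξ + Complex.I • toComplex (-η)) with hg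
      have hFeq : F =ᶠ[𝓝 p] fun q => (1 - (b q : ℂ)) * ((powSum M q : ℂ)⁻¹ *
          ((Real.exp (ε * ‖q‖ - inner ℝ η q) : ℂ) * g q)) := by
        filter_upwards [hU.mem_nhds hpU] with q hq
        have h1 := kernel_eqOn_kernel hθ hH hest hN (M := M) (by linarith) hq
        have h2 := fourier_derivSymbol_eq_exp_mul hH hest (N := M) (by linarith)
          (hηn.trans_lt hεθ) q
        simp only [hF]
        rw [h1, kernel, h2, sub_eq_add_neg (ε * ‖q‖), Real.exp_add]
        push_cast
        ring
      rw [(hFeq.iteratedFDeriv ℝ j).eq_of_nhds]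
      have hexpη : ContDiffOn ℝ j
          (fun q : EuclideanSpace ℝ (Fin n) => (Real.exp (ε * ‖q‖ - inner ℝ η q) : ℂ)) {0}ᶜ := by
        refine (Complex.ofRealCLM.contDiff.comp Real.contDiff_exp).comp_contDiffOn
          ((contDiffOn_const.mul (contDiffOn_id.norm ℝ fun q hq => hq)).sub ?_)
        exact (innerSL ℝ η).contDiff.contDiffOn
      have hQ := (contDiffOn_inv_powSum (n := n) M).of_le
        (show (j : WithTop ℕ∞) ≤ ∞ by exact_mod_cast le_top)
      have hb' := (hb.contDiffOn (s := {0}ᶜ)).of_le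
        (show (j : WithTop ℕ∞) ≤ ∞ by exact_mod_cast le_top)
      have h1 := norm_iteratedFDeriv_mul_le_of_isOpen hU hpU hexpη hGc.contDiffOn
        (hD p hp) (fun i hi => hGb i hi p)
      have h2 := norm_iteratedFDeriv_mul_le_of_isOpen hU hpU hQ (hexpη.mul hGc.contDiffOn)
        (hB p hp) h1
      exact norm_iteratedFDeriv_mul_le_of_isOpen hU hpU hb'
        (hQ.mul (hexpη.mul hGc.contDiffOn)) (hA' p) h2 j le_rfl
  · have hbp : b p = 0 := b.zero_of_le_dist (by simpa using hp.le)
    simp only [hF, hbp]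
    rw [Complex.ofReal_zero, sub_zero, one_mul, ← mul_assoc, ← Complex.ofReal_mul, ← Real.exp_add]
    simp

end FourierDecay

end

theorem mainTheorem7 (n : ℕ) (θ : ℝ) (hθ : 0 < θ) (m : ℝ)
    (H : EuclideanSpace ℂ (Fin n) → ℂ)
    (hH : DifferentiableOn ℂ H (FourierDecay.strip n θ))
    (hest : FourierDecay.SymbolEstimates θ m H) :
    ∃ κ : FourierDecay.Test n →L[ℂ] ℂ, FourierDecay.IsFourierPairing H κ ∧
      ∃ k : EuclideanSpace ℝ (Fin n) → ℂ, FourierDecay.EqSmoothOn κ {0}ᶜ k ∧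
        ∀ ε : ℝ, 0 < ε → ε < θ →
          ∃ F : EuclideanSpace ℝ (Fin n) → ℂ, FourierDecay.SmoothBounded F ∧
            ∀ p : EuclideanSpace ℝ (Fin n), 1 < ‖p‖ →
              k p = (Real.exp (-(ε * ‖p‖)) : ℂ) * F p := by
  obtain ⟨κ, hκ⟩ := hest.exists_fourierPairing hθ hH
  -- Exactly the condition `2 * N - m > n` for the differentiated symbol to be integrable.
  obtain ⟨N, hN⟩ := exists_nat_gt (((n : ℝ) + m) / 2)
  have hN' : (n : ℝ) < 2 * N - m := by linarith
  exact ⟨κ, hκ, FourierDecay.kernel N H,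
    ⟨FourierDecay.contDiffOn_infty_kernel hθ hH hest hN',
      fun f hf => hκ.eq_integral_kernel hθ hH hest hN' f hf⟩,
    fun ε hε hεθ => FourierDecay.exists_smoothBounded_kernel_eq hθ hH hest hN' hε hεθ⟩
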